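/- Let $\nu\ge 2$ be an integer and let $\varepsilon>0$. There is a constant $C=C(\varepsilon,\nu)$, depending only on $\varepsilon$ and $\nu$, with the following property. Let $q\in\mathbb{Z}[T_1,\dots,T_\nu]$ be a polynomial of total degree $2$ that is irreducible over $\mathbb{Q}$ (that is, in $\mathbb{Q}[T_1,\dots,T_\nu]$), and suppose that its quadratic part $q_0$ (the homogeneous component of $q$ of degree $2$) has rank at least $2$ as a quadratic form over $\mathbb{Q}$. Then for every real $B\ge 1$, $$\#\Big\{\mathbf{t}=(t_1,\dots,t_\nu)\in\mathbb{Z}^\nu:\ \max_{1\le i\le\nu}|t_i|\le B,\ q(\mathbf{t})=0\Big\}\le C\,B^{\nu-2+\varepsilon}.$$ -/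

import Mathlib

/-- The quadratic part `q₀` of `q`: the sum of all its monomials of total degree two. -/
noncomputable def quadraticPart {ν : ℕ} (q : MvPolynomial (Fin ν) ℤ) : MvPolynomial (Fin ν) ℤ :=
  MvPolynomial.homogeneousComponent 2 q

/-- The symmetric matrix over `ℚ` of the quadratic form `Q`: its diagonal entries are the
coefficients of the squares `T_i ^ 2`, its off-diagonal entries are half the coefficients of
`T_i * T_j`. -/
noncomputable def formMatrix {ν : ℕ} (Q : MvPolynomial (Fin ν) ℤ) : Matrix (Fin ν) (Fin ν) ℚ :=
  Matrix.of fun i j =>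
    if i = j then ((Q.coeff (Finsupp.single i 2) : ℤ) : ℚ)
    else ((Q.coeff (Finsupp.single i 1 + Finsupp.single j 1) : ℤ) : ℚ) / 2

/-- The set of integer zeros `t` of `q` with `max_i |t_i| ≤ B`. -/
def zerosInBox {ν : ℕ} (q : MvPolynomial (Fin ν) ℤ) (B : ℝ) : Set (Fin ν → ℤ) :=
  {t | (∀ i, |(t i : ℝ)| ≤ B) ∧ MvPolynomial.eval t q = 0}

/-- The set that is counted is finite, so that its `Set.ncard` is its number of elements. -/
theorem zerosInBox_finite {ν : ℕ} (q : MvPolynomial (Fin ν) ℤ) (B : ℝ) :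
    (zerosInBox q B).Finite := by
  refine (Set.Finite.pi' (fun _ : Fin ν => Set.finite_Icc (-⌊B⌋) ⌊B⌋)).subset ?_
  intro t ht i
  have h := abs_le.mp (ht.1 i)
  refine ⟨?_, Int.le_floor.mpr h.2⟩
  have h2 : -t i ≤ ⌊B⌋ := Int.le_floor.mpr (by push_cast; linarith [h.1])
  linarith

/-- The number `M(q;B)` of integer zeros `t` of `q` with `max_i |t_i| ≤ B`. -/
noncomputable def zeroCount {ν : ℕ} (q : MvPolynomial (Fin ν) ℤ) (B : ℝ) : ℕ :=
  (zerosInBox q B).ncard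

/-! Slice the quadric by parallel planes. As `q₀` has rank at least two, some integer vectors `u`,
`v` with entries at most 2 in absolute value span a plane on which `q₀` is nondegenerate
(`Matrix.IsSymm.exists_small_discriminant_ne_zero`). Counting triples (zero, x, y) with 0 ≤ x, y ≤ L
bounds L² times the number of zeros by a sum, over O(L^ν) translates `s`, of the number of zeros `s
- x u - y v` (`card_mul_sq_le_sum_card_fibres`). So it suffices that a fibre has O(L^ε) points on
average.

Each fibre is a conic in (x, y) whose quadratic part, of discriminant D ≠ 0, does not depend on `s`.
Its degeneracy is detected by `fibreDiscriminant`, of degree at most 2 in `s`. If this polynomial is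
nonzero, Schwartz–Zippel leaves O(L^(ν-1)) degenerate fibres, with O(L) points each. If it vanishes
identically, a square D would split `q` into affine factors, against irreducibility; so D is not a
square, and each fibre has at most one point.

For nondegenerate fibres, `exists_card_conic_zeros_le_rpow` must be uniform in the coefficients. The
points found in the box impose linear conditions on the coefficient vector, so they also lie on a
nondegenerate conic with coefficients O(L^12) (`exists_small_solution_eval_ne_zero`). Completing the
square turns it into X² - D Y² = N with D and N of polynomial size. The solutions fall into at most
d(N)² classes, in each of which quotients have integral trace, so that a class has O(log L) members
(`card_norm_le`); the divisor bound finishes. -/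

/-! ### The divisor bound. -/

theorem exists_card_divisors_le_rpow (ε : ℝ) (hε : 0 < ε) :
    ∃ C : ℝ, 0 < C ∧ ∀ n : ℕ, n ≠ 0 → (n.divisors.card : ℝ) ≤ C * (n : ℝ) ^ ε := by
  -- Chosen so that k + 1 ≤ c (1 + k ε log 2) ≤ c · 2^(kε) for every k, which handles the primes
  -- below `P`.
  set c : ℝ := max 1 (1 / (ε * Real.log 2)) with hc
  have hl : 0 < Real.log 2 := Real.log_pos (by norm_num)
  have hεl : 0 < ε * Real.log 2 := mul_pos hε hl
  have hc1 : 1 ≤ c := le_max_left _ _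
  have hc2 : 1 ≤ c * (ε * Real.log 2) := by
    have : 1 / (ε * Real.log 2) ≤ c := le_max_right _ _
    rwa [div_le_iff₀ hεl] at this
  -- Primes from here on satisfy p^ε ≥ 2, so that k + 1 ≤ 2^k ≤ p^(kε) without loss.
  set P : ℕ := ⌈(2 : ℝ) ^ (1 / ε)⌉₊ with hP
  refine ⟨c ^ P, by positivity, fun n hn => ?_⟩
  rw [Nat.card_divisors hn]
  push_cast
  have key : ∀ p ∈ n.primeFactors, ((n.factorization p : ℝ) + 1) ≤
      (if p < P then c else 1) * ((p : ℝ) ^ n.factorization p) ^ ε := by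
    intro p hp
    have hpp := Nat.prime_of_mem_primeFactors hp
    have hp2 : (2 : ℝ) ≤ p := by exact_mod_cast hpp.two_le
    set k := n.factorization p
    have e1 : ((p : ℝ) ^ k) ^ ε = ((p : ℝ) ^ ε) ^ k := by
      rw [← Real.rpow_natCast, ← Real.rpow_natCast, ← Real.rpow_mul (by positivity),
        ← Real.rpow_mul (by positivity), mul_comm]
    rw [e1]
    split_ifs with h
    · have h1 : 1 + k * (ε * Real.log 2) ≤ ((p : ℝ) ^ ε) ^ k := by
        have h2 : ((2 : ℝ) ^ ε) ^ k ≤ ((p : ℝ) ^ ε) ^ k := by gcongr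
        refine le_trans ?_ h2
        have h3 : ((2 : ℝ) ^ ε) ^ k = Real.exp (k * (ε * Real.log 2)) := by
          rw [Real.rpow_def_of_pos (by norm_num), ← Real.exp_nat_mul]; ring_nf
        rw [h3, add_comm]
        exact Real.add_one_le_exp _
      have hk : (0 : ℝ) ≤ k := by positivity
      nlinarith
    · have h1 : (2 : ℝ) ≤ (p : ℝ) ^ ε := by
        have h2 : (2 : ℝ) ^ (1 / ε) ≤ p := (Nat.le_ceil _).trans (by exact_mod_cast not_lt.mp h)
        calc (2 : ℝ) = ((2 : ℝ) ^ (1 / ε)) ^ ε := by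
              rw [← Real.rpow_mul (by norm_num), one_div, inv_mul_cancel₀ hε.ne', Real.rpow_one]
          _ ≤ _ := by gcongr
      rw [one_mul]
      calc (k : ℝ) + 1 ≤ 2 ^ k := by exact_mod_cast Nat.lt_two_pow_self
        _ ≤ _ := by gcongr
  have hn' : ∏ p ∈ n.primeFactors, ((p : ℝ) ^ n.factorization p) ^ ε = (n : ℝ) ^ ε := by
    rw [Real.finsetProd_rpow _ _ (fun _ _ => by positivity)]
    congr 1
    have := Nat.prod_factorization_pow_eq_self hn
    conv_rhs => rw [← this]
    simp [Finsupp.prod]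
  calc ∏ p ∈ n.primeFactors, ((n.factorization p : ℝ) + 1)
      ≤ ∏ p ∈ n.primeFactors, (if p < P then c else 1) * ((p : ℝ) ^ n.factorization p) ^ ε :=
        Finset.prod_le_prod (fun _ _ => by positivity) key
    _ = (∏ p ∈ n.primeFactors, if p < P then c else 1) * (n : ℝ) ^ ε := by
        rw [Finset.prod_mul_distrib, hn']
    _ ≤ c ^ P * (n : ℝ) ^ ε := by
        gcongr
        rw [Finset.prod_ite, Finset.prod_const, Finset.prod_const_one, mul_one]
        refine pow_le_pow_right₀ hc1 ?_
        calc _ ≤ (Finset.range P).card := Finset.card_le_card (fun x hx => by simp at hx ⊢; tauto)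
          _ = P := Finset.card_range P

/-! ### Representations by the norm form X² - D Y². -/

/-- Points of `X ^ 2 - D * Y ^ 2 = N` with `D > 0` whose pairwise quotients have integral trace are
spaced out exponentially. -/
theorem card_norm_class_le_of_pos {D N : ℤ} {k : ℕ} (hD : 0 < D) (hN : N ≠ 0) (hDk : D ≤ 2 ^ k)
    (T : Finset (ℤ × ℤ)) (hT : ∀ α ∈ T, α.1 ^ 2 - D * α.2 ^ 2 = N)
    (hk : ∀ α ∈ T, |α.1| ≤ 2 ^ k ∧ |α.2| ≤ 2 ^ k)
    (hp : ∀ α ∈ T, ∀ β ∈ T, N ∣ 2 * (α.1 * β.1 - D * α.2 * β.2)) :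
    T.card ≤ 8 * k + 6 := by
  set r : ℝ := Real.sqrt D with hr
  have hDr : (0 : ℝ) < D := by exact_mod_cast hD
  have hr2 : r ^ 2 = D := Real.sq_sqrt hDr.le
  have hr0 : 0 < r := Real.sqrt_pos.mpr hDr
  have hrk : r ≤ 2 ^ k := by
    have h1 : (1 : ℝ) ≤ D := by exact_mod_cast hD
    have h2 : (D : ℝ) ≤ 2 ^ k := by exact_mod_cast hDk
    nlinarith
  set θ : ℤ × ℤ → ℝ := fun α => α.1 + α.2 * r with hθ
  set θ' : ℤ × ℤ → ℝ := fun α => α.1 - α.2 * r with hθ'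
  have hN1 : (1 : ℝ) ≤ |(N : ℝ)| := by exact_mod_cast Int.one_le_abs hN
  have hmul : ∀ α ∈ T, θ α * θ' α = N := by
    intro α hα
    have : ((α.1 : ℝ) ^ 2 - D * α.2 ^ 2) = N := by exact_mod_cast hT α hα
    simp only [hθ, hθ']
    rw [← this, ← hr2]; ring
  have hNr : (N : ℝ) ≠ 0 := by exact_mod_cast hN
  have hne : ∀ α ∈ T, θ α ≠ 0 := fun α hα h => hNr (by rw [← hmul α hα, h, zero_mul])
  have hne' : ∀ α ∈ T, θ' α ≠ 0 := fun α hα h => hNr (by rw [← hmul α hα, h, mul_zero])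
  have hbd : ∀ α ∈ T, |θ α| ≤ 2 ^ (2 * k + 1) ∧ |θ' α| ≤ 2 ^ (2 * k + 1) := by
    intro α hα
    have h1 : |(α.1 : ℝ)| ≤ 2 ^ k := by exact_mod_cast (hk α hα).1
    have h2 : |(α.2 : ℝ)| ≤ 2 ^ k := by exact_mod_cast (hk α hα).2
    have h3 : |(α.2 : ℝ) * r| ≤ 2 ^ k * 2 ^ k := by
      rw [abs_mul, abs_of_pos hr0]; gcongr
    have h4 : (2 : ℝ) ^ k ≤ 2 ^ k * 2 ^ k := le_mul_of_one_le_left (by positivity)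
      (one_le_pow₀ (by norm_num))
    have h5 : (2 : ℝ) ^ (2 * k + 1) = 2 ^ k * 2 ^ k + 2 ^ k * 2 ^ k := by ring
    rw [h5]
    exact ⟨(abs_add_le _ _).trans (by linarith), (abs_sub _ _).trans (by linarith)⟩
  have hlow : ∀ α ∈ T, (2 : ℝ) ^ (-((2 * k + 1 : ℕ) : ℤ)) ≤ |θ α| := by
    intro α hα
    rw [zpow_neg, zpow_natCast, inv_le_iff_one_le_mul₀ (by positivity)]
    calc 1 ≤ |(N : ℝ)| := hN1
      _ = |θ α| * |θ' α| := by rw [← hmul α hα, abs_mul]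
      _ ≤ _ := by gcongr; exact (hbd α hα).2
  set t : Finset (Bool × ℤ) :=
    Finset.univ ×ˢ Finset.Icc (-((2 * k + 1 : ℕ) : ℤ)) ((2 * k + 1 : ℕ) : ℤ) with ht
  have htc : t.card = 8 * k + 6 := by
    rw [ht, Finset.card_product, Int.card_Icc, Finset.card_univ, Fintype.card_bool]
    omega
  rw [← htc]
  -- A point is determined by the sign and the dyadic size of θ = X + Y√D: two points sharing both
  -- have quotient η in (1/2, 2).
  refine Finset.card_le_card_of_injOn (fun α => (decide (0 < θ α), Int.log 2 |θ α|)) ?_ ?_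
  · intro α hα
    have hα : α ∈ T := hα
    have h0 : 0 < |θ α| := abs_pos.mpr (hne α hα)
    simp only [ht, Finset.coe_product, Set.mem_prod, Finset.coe_univ, Set.mem_univ, true_and,
      Finset.coe_Icc, Set.mem_Icc]
    constructor
    · rw [← Int.zpow_le_iff_le_log (by norm_num) h0]
      exact_mod_cast hlow α hα
    · have h1 := Int.zpow_log_le_self (b := 2) (by norm_num) h0
      have h2 : ((2 : ℕ) : ℝ) ^ Int.log 2 |θ α| ≤ ((2 : ℕ) : ℝ) ^ ((2 * k + 1 : ℕ) : ℤ) := by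
        refine h1.trans ?_
        rw [zpow_natCast]
        exact_mod_cast (hbd α hα).1
      exact (zpow_le_zpow_iff_right₀ (by norm_num)).mp h2
  · intro α hα β hβ hab
    have hα : α ∈ T := hα
    have hβ : β ∈ T := hβ
    simp only [Prod.mk.injEq, decide_eq_decide] at hab
    obtain ⟨hs, hlg⟩ := hab
    set η : ℝ := θ α / θ β with hη
    have hηpos : 0 < η := by
      rcases lt_or_gt_of_ne (hne α hα) with h | h
      · have : θ β < 0 := lt_of_le_of_ne (not_lt.mp (fun h' => (hs.mpr h').not_gt h)) (hne β hβ)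
        exact div_pos_of_neg_of_neg h this
      · exact div_pos h (hs.mp h)
    have habs : ∀ a b : ℤ × ℤ, a ∈ T → b ∈ T → Int.log 2 |θ a| = Int.log 2 |θ b| →
        |θ a| < 2 * |θ b| := by
      intro a b ha hb hl
      have h1 := Int.zpow_log_le_self (b := 2) (by norm_num) (abs_pos.mpr (hne b hb))
      have h2 := Int.lt_zpow_succ_log_self (b := 2) (by norm_num) |θ a|
      rw [hl, zpow_add_one₀ (by norm_num)] at h2
      push_cast at h1 h2
      linarith
    have hη2 : η < 2 := by
      rw [← abs_of_pos hηpos, hη, abs_div, div_lt_iff₀ (abs_pos.mpr (hne β hβ))]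
      exact habs α β hα hβ hlg
    have hη3 : 1 < 2 * η := by
      rw [← abs_of_pos hηpos, hη, abs_div, ← mul_div_assoc, lt_div_iff₀ (abs_pos.mpr (hne β hβ)),
        one_mul]
      exact habs β α hβ hα hlg.symm
    obtain ⟨u, hu⟩ := hp α hα β hβ
    have hur : 2 * ((α.1 : ℝ) * β.1 - D * α.2 * β.2) = N * u := by exact_mod_cast hu
    have hηi : η = θ α * θ' β / N := by
      rw [hη, ← hmul β hβ]
      field_simp [hne β hβ, hne' β hβ]
    have hηi' : η⁻¹ = θ' α * θ β / N := by
      rw [hη, ← hmul α hα, inv_div]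
      field_simp [hne α hα, hne' α hα]
    have hsum : η + η⁻¹ = u := by
      rw [hηi', hηi, ← add_div, div_eq_iff hNr, mul_comm (u : ℝ), ← hur, ← hr2]
      simp only [hθ, hθ']; ring
    have hq : η ^ 2 + 1 = u * η := by
      rw [← hsum]; field_simp
    -- The integer `u` is η + 1/η, which lies in [2, 5/2); hence it equals 2 and η = 1.
    have hu3 : u < 3 := by
      have : (u : ℝ) < 3 := by nlinarith
      exact_mod_cast this
    have hu1 : 1 < u := by
      have : (1 : ℝ) < u := by nlinarith [sq_nonneg (η - 1)]
      exact_mod_cast this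
    have hu2 : u = 2 := by omega
    have hη1 : η = 1 := by
      rw [hu2] at hq
      push_cast at hq
      have : (η - 1) ^ 2 = 0 := by linarith
      have := pow_eq_zero_iff (two_ne_zero) |>.mp this
      linarith
    have e1 : θ α = θ β := by rw [hη, div_eq_one_iff_eq (hne β hβ)] at hη1; exact hη1
    have e2 : θ' α = θ' β := by
      have := (hmul α hα).trans (hmul β hβ).symm
      rw [e1] at this
      exact mul_left_cancel₀ (hne β hβ) this
    simp only [hθ, hθ'] at e1 e2
    have f1 : (α.1 : ℝ) = β.1 := by linarith
    have f2 : (α.2 : ℝ) = β.2 := mul_right_cancel₀ hr0.ne' (by linarith)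
    exact Prod.ext (by exact_mod_cast f1) (by exact_mod_cast f2)

/-- Doubled quotients by a fixed β have integral coordinates (u, v) with u² - D v² = 4. For D < 0
this forces |u|, |v| ≤ 2, and the pair recovers the point. -/
theorem card_norm_class_le_of_neg {D N : ℤ} (hD : D < 0) (hN : N ≠ 0)
    (T : Finset (ℤ × ℤ)) (hT : ∀ α ∈ T, α.1 ^ 2 - D * α.2 ^ 2 = N)
    (hp : ∀ α ∈ T, ∀ β ∈ T, N ∣ 2 * (α.1 * β.1 - D * α.2 * β.2))
    (hp' : ∀ α ∈ T, ∀ β ∈ T, N ∣ 2 * (α.1 * β.2 - β.1 * α.2)) :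
    T.card ≤ 25 := by
  rcases T.eq_empty_or_nonempty with rfl | ⟨β, hβ⟩
  · simp
  have e : ∀ α ∈ T, ∃ uv : ℤ × ℤ, 2 * (α.1 * β.1 - D * α.2 * β.2) = N * uv.1 ∧
      2 * (α.1 * β.2 - β.1 * α.2) = N * uv.2 := by
    intro α hα
    obtain ⟨u, hu⟩ := hp α hα β hβ
    obtain ⟨v, hv⟩ := hp' α hα β hβ
    exact ⟨(u, v), hu, hv⟩
  choose! f hf using e
  have : (Finset.Icc (-2 : ℤ) 2 ×ˢ Finset.Icc (-2 : ℤ) 2).card = 25 := rfl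
  rw [← this]
  refine Finset.card_le_card_of_injOn f ?_ ?_
  · intro α hα
    have hα : α ∈ T := hα
    obtain ⟨h1, h2⟩ := hf α hα
    have h3 : N ^ 2 * ((f α).1 ^ 2 - D * (f α).2 ^ 2) = N ^ 2 * 4 := by
      have : (N * (f α).1) ^ 2 - D * (N * (f α).2) ^ 2 = 4 * (N * N) := by
        rw [← h1, ← h2]
        nth_rewrite 1 [← hT α hα]
        rw [← hT β hβ]; ring
      linarith
    have h4 := mul_left_cancel₀ (pow_ne_zero 2 hN) h3
    simp only [Finset.coe_product, Finset.coe_Icc, Set.mem_prod, Set.mem_Icc]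
    have h5 : (f α).1 ^ 2 ≤ 4 := by nlinarith [sq_nonneg (f α).2]
    have h6 : (f α).2 ^ 2 ≤ 4 := by nlinarith [sq_nonneg (f α).1, sq_nonneg (f α).2]
    refine ⟨⟨?_, ?_⟩, ?_, ?_⟩ <;> nlinarith
  · intro α hα γ hγ h
    have hα : α ∈ T := hα
    have hγ : γ ∈ T := hγ
    obtain ⟨h1, h2⟩ := hf α hα
    obtain ⟨h3, h4⟩ := hf γ hγ
    rw [← h] at h3 h4
    have g1 : α.1 * β.1 - D * α.2 * β.2 = γ.1 * β.1 - D * γ.2 * β.2 := by linarith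
    have g2 : α.1 * β.2 - β.1 * α.2 = γ.1 * β.2 - β.1 * γ.2 := by linarith
    have k1 : N * α.1 = N * γ.1 := by
      rw [← hT β hβ]; linear_combination β.1 * g1 - D * β.2 * g2
    have k2 : N * α.2 = N * γ.2 := by
      rw [← hT β hβ]; linear_combination β.2 * g1 - β.1 * g2
    exact Prod.ext (mul_left_cancel₀ hN k1) (mul_left_cancel₀ hN k2)

theorem card_norm_class_le {D N : ℤ} {k : ℕ} (hD : D ≠ 0) (hN : N ≠ 0) (hDk : |D| ≤ 2 ^ k)
    (T : Finset (ℤ × ℤ)) (hT : ∀ α ∈ T, α.1 ^ 2 - D * α.2 ^ 2 = N)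
    (hk : ∀ α ∈ T, |α.1| ≤ 2 ^ k ∧ |α.2| ≤ 2 ^ k)
    (hp : ∀ α ∈ T, ∀ β ∈ T, N ∣ 2 * (α.1 * β.1 - D * α.2 * β.2))
    (hp' : ∀ α ∈ T, ∀ β ∈ T, N ∣ 2 * (α.1 * β.2 - β.1 * α.2)) :
    T.card ≤ 8 * k + 25 := by
  rcases lt_or_gt_of_ne hD with h | h
  · exact (card_norm_class_le_of_neg h hN T hT hp hp').trans (by omega)
  · exact (card_norm_class_le_of_pos h hN ((le_abs_self _).trans hDk) T hT hk hp).trans (by omega)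

theorem dvd_two_mul_of_dvd_of_dvd {g h W : ℤ} (hg : g ∣ W) (hh : h ∣ W)
    (h2 : (Int.gcd g h : ℤ) ∣ 2) : g * h ∣ 2 * W := by
  obtain ⟨c, hc⟩ := h2
  rw [hc, Int.gcd_eq_gcd_ab]
  have e : (g * g.gcdA h + h * g.gcdB h) * c * W =
    g * W * (g.gcdA h * c) + W * h * (g.gcdB h * c) := by ring
  rw [e]
  exact dvd_add (Dvd.dvd.mul_right (mul_dvd_mul_left g hh) _)
    (Dvd.dvd.mul_right (mul_dvd_mul_right hg h) _)

theorem isCoprime_snd_of_norm_eq {D N X Y : ℤ} (h : IsCoprime X Y) (e : X ^ 2 - D * Y ^ 2 = N) :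
    IsCoprime N Y := by
  have : N = X ^ 2 + Y * (-D * Y) := by rw [← e]; ring
  rw [this]
  exact (IsCoprime.pow_left h).add_mul_left_left _

/-- Fix a solution α. For another solution β, N divides the product (α₁β₂ - β₁α₂)(α₁β₂ + β₁α₂), and
the gcd g of N with the first factor records how N splits between the two. Solutions with the same g
have all their pairwise quotients integral up to a factor 2, so each of the d(N) possible values of
g gives one small class. -/
theorem card_primitive_norm_le_of_no_common_sq {D N : ℤ} {k : ℕ} (hD : D ≠ 0) (hN : N ≠ 0)
    (hDk : |D| ≤ 2 ^ k) (hsq : ∀ e : ℤ, e ^ 2 ∣ D → e ^ 2 ∣ N → IsUnit e)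
    (T : Finset (ℤ × ℤ)) (hT : ∀ α ∈ T, α.1 ^ 2 - D * α.2 ^ 2 = N)
    (hk : ∀ α ∈ T, |α.1| ≤ 2 ^ k ∧ |α.2| ≤ 2 ^ k) (hc : ∀ α ∈ T, IsCoprime α.1 α.2) :
    T.card ≤ (8 * k + 25) * N.natAbs.divisors.card := by
  rcases T.eq_empty_or_nonempty with rfl | ⟨α, hα⟩
  · simp
  have hcN : ∀ β ∈ T, IsCoprime N β.2 := fun β hβ => isCoprime_snd_of_norm_eq (hc β hβ) (hT β hβ)
  refine Finset.card_le_mul_card_image_of_maps_to (f := fun β => Int.gcd N (α.1 * β.2 - β.1 * α.2))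
    ?_ _ ?_
  · intro β _
    rw [Nat.mem_divisors]
    exact ⟨Int.natCast_dvd.mp (Int.gcd_dvd_left _ _), by simpa using hN⟩
  intro g _
  have hmem : ∀ β ∈ T.filter (fun β => Int.gcd N (α.1 * β.2 - β.1 * α.2) = g), β ∈ T ∧
      (g : ℤ) ∣ α.1 * β.2 - β.1 * α.2 ∧ ∃ h, N = g * h ∧ h ∣ α.1 * β.2 + β.1 * α.2 := by
    intro β hβ
    rw [Finset.mem_filter] at hβ
    obtain ⟨hβ, rfl⟩ := hβ
    refine ⟨hβ, Int.gcd_dvd_right _ _, ?_⟩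
    set A := α.1 * β.2 - β.1 * α.2 with hA
    obtain ⟨h, hh⟩ := Int.gcd_dvd_left N A
    obtain ⟨a, ha⟩ := Int.gcd_dvd_right N A
    refine ⟨h, hh, ?_⟩
    have hg0 : (Int.gcd N A : ℤ) ≠ 0 := fun h0 => hN (by rw [hh, h0, zero_mul])
    have hcop : IsCoprime h a := by
      have h1 : (Int.gcd N A : ℤ) * (h * N.gcdA A + a * N.gcdB A) = Int.gcd N A * 1 := by
        have := Int.gcd_eq_gcd_ab N A
        calc _ = (Int.gcd N A : ℤ) * h * N.gcdA A + Int.gcd N A * a * N.gcdB A := by ring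
          _ = _ := by rw [← hh, ← ha, mul_one]; exact this.symm
      exact ⟨N.gcdA A, N.gcdB A, by linarith [mul_left_cancel₀ hg0 h1]⟩
    refine hcop.dvd_of_dvd_mul_left ⟨β.2 ^ 2 - α.2 ^ 2, ?_⟩
    apply mul_left_cancel₀ hg0
    have h2 : A * (α.1 * β.2 + β.1 * α.2) = N * (β.2 ^ 2 - α.2 ^ 2) := by
      rw [hA]
      linear_combination β.2 ^ 2 * hT α hα - α.2 ^ 2 * hT β hβ
    calc _ = (Int.gcd N A * a) * (α.1 * β.2 + β.1 * α.2) := by ring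
      _ = N * (β.2 ^ 2 - α.2 ^ 2) := by rw [← ha, h2]
      _ = (Int.gcd N A * h) * (β.2 ^ 2 - α.2 ^ 2) := by rw [← hh]
      _ = _ := by ring
  have hW : ∀ β ∈ T.filter (fun β => Int.gcd N (α.1 * β.2 - β.1 * α.2) = g),
      ∀ γ ∈ T.filter (fun β => Int.gcd N (α.1 * β.2 - β.1 * α.2) = g),
      N ∣ 2 * (β.1 * γ.2 - γ.1 * β.2) := by
    intro β hβ' γ hγ'
    obtain ⟨hβ, hgβ, h, hNh, hhβ⟩ := hmem β hβ'
    obtain ⟨hγ, hgγ, h', hNh', hhγ⟩ := hmem γ hγ'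
    have hg0 : (g : ℤ) ≠ 0 := fun h0 => hN (by rw [hNh, h0, zero_mul])
    have : h' = h := mul_left_cancel₀ hg0 (hNh'.symm.trans hNh)
    subst this
    have hcg : IsCoprime (g : ℤ) α.2 := (hcN α hα).of_isCoprime_of_dvd_left ⟨h', hNh⟩
    have hch : IsCoprime h' α.2 := (hcN α hα).of_isCoprime_of_dvd_left ⟨g, by rw [hNh]; ring⟩
    have d1 : (g : ℤ) ∣ β.1 * γ.2 - γ.1 * β.2 := by
      refine hcg.dvd_of_dvd_mul_left ?_
      have e : α.2 * (β.1 * γ.2 - γ.1 * β.2) =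
        (α.1 * γ.2 - γ.1 * α.2) * β.2 - (α.1 * β.2 - β.1 * α.2) * γ.2 := by ring
      rw [e]
      exact dvd_sub (hgγ.mul_right _) (hgβ.mul_right _)
    have d2 : h' ∣ β.1 * γ.2 - γ.1 * β.2 := by
      refine hch.dvd_of_dvd_mul_left ?_
      have e : α.2 * (β.1 * γ.2 - γ.1 * β.2) =
        (α.1 * β.2 + β.1 * α.2) * γ.2 - (α.1 * γ.2 + γ.1 * α.2) * β.2 := by ring
      rw [e]
      exact dvd_sub (hhβ.mul_right _) (hhγ.mul_right _)
    -- A common divisor of `g` and `h'` divides the sum 2α₁β₂ of the two factors, hence 2α₁. Any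
    -- part e of it dividing α₁ has e² ∣ N and then e² ∣ D, so it is a unit by `hsq`.
    have hc2 : (Int.gcd g h' : ℤ) ∣ 2 := by
      set c : ℤ := ((Int.gcd g h' : ℕ) : ℤ)
      have cg : c ∣ g := Int.gcd_dvd_left _ _
      have ch : c ∣ h' := Int.gcd_dvd_right _ _
      have cN : c ^ 2 ∣ N := by rw [hNh, sq]; exact mul_dvd_mul cg ch
      have cop : IsCoprime c β.2 := (hcN β hβ).of_isCoprime_of_dvd_left
        (cg.trans ⟨h', hNh⟩)
      have copα : IsCoprime c α.2 := hcg.of_isCoprime_of_dvd_left cg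
      have key : ∀ e : ℤ, e ∣ c → e ∣ α.1 → IsUnit e := by
        intro e he he1
        have heN : e ^ 2 ∣ N := (pow_dvd_pow_of_dvd he 2).trans cN
        refine hsq e ?_ heN
        have hcop : IsCoprime (e ^ 2) (α.2 ^ 2) := (copα.of_isCoprime_of_dvd_left he).pow
        refine hcop.dvd_of_dvd_mul_right ?_
        have : D * α.2 ^ 2 = α.1 ^ 2 - N := by rw [← hT α hα]; ring
        rw [this]
        exact dvd_sub (pow_dvd_pow_of_dvd he1 2) heN
      have h2 : c ∣ 2 * α.1 := by
        refine cop.dvd_of_dvd_mul_right ?_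
        have e : 2 * α.1 * β.2 = (α.1 * β.2 - β.1 * α.2) + (α.1 * β.2 + β.1 * α.2) := by ring
        rw [e]
        exact dvd_add (cg.trans hgβ) (ch.trans hhβ)
      rcases Int.even_or_odd c with ⟨c', hc'⟩ | hodd
      · have hc'' : c = 2 * c' := by rw [hc']; ring
        have := key c' ⟨2, by rw [hc'']; ring⟩ (by
          rw [hc''] at h2; exact (mul_dvd_mul_iff_left two_ne_zero).mp h2)
        rw [hc'']
        rcases Int.isUnit_iff.mp this with h | h <;> rw [h] <;> norm_num
      · have hcop2 : IsCoprime c 2 := by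
          obtain ⟨m, hm⟩ := hodd
          exact ⟨1, -m, by rw [hm]; ring⟩
        exact (key c dvd_rfl (hcop2.dvd_of_dvd_mul_left h2)).dvd
    rw [hNh]
    exact dvd_two_mul_of_dvd_of_dvd d1 d2 hc2
  refine card_norm_class_le hD hN hDk _ (fun β hβ => hT β (hmem β hβ).1)
    (fun β hβ => hk β (hmem β hβ).1) ?_ hW
  intro β hβ γ hγ
  have hγT := (hmem γ hγ).1
  refine (hcN γ hγT).dvd_of_dvd_mul_right ?_
  have e : 2 * (β.1 * γ.1 - D * β.2 * γ.2) * γ.2 =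
      2 * (β.1 * γ.2 - γ.1 * β.2) * γ.1 + N * (2 * β.2) := by
    rw [← hT γ hγT]; ring
  rw [e]
  exact dvd_add ((hW β hβ γ hγ).mul_right _) (dvd_mul_right _ _)

theorem card_divisors_natAbs_le_of_dvd {M N : ℤ} (hN : N ≠ 0) (h : M ∣ N) :
    M.natAbs.divisors.card ≤ N.natAbs.divisors.card :=
  Finset.card_le_card (Nat.divisors_subset_of_dvd (by simpa using hN) (Int.natAbs_dvd_natAbs.mpr h))

theorem abs_le_of_eq_mul {a b c M : ℤ} (hb : b ≠ 0) (h : a = b * c) (ha : |a| ≤ M) : |c| ≤ M := by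
  have h1 := Int.one_le_abs hb
  rw [h, abs_mul] at ha
  nlinarith [abs_nonneg c]

/-- The largest square b² dividing gcd(D, N) forces b ∣ X; replacing X by X / b and dividing D and N
by b² removes the common square. -/
theorem card_primitive_norm_le {D N : ℤ} {k : ℕ} (hD : D ≠ 0) (hN : N ≠ 0)
    (hDk : |D| ≤ 2 ^ k)
    (T : Finset (ℤ × ℤ)) (hT : ∀ α ∈ T, α.1 ^ 2 - D * α.2 ^ 2 = N)
    (hk : ∀ α ∈ T, |α.1| ≤ 2 ^ k ∧ |α.2| ≤ 2 ^ k) (hc : ∀ α ∈ T, IsCoprime α.1 α.2) :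
    T.card ≤ (8 * k + 25) * N.natAbs.divisors.card := by
  obtain ⟨a, b, hab, ha⟩ := Nat.sq_mul_squarefree (Int.gcd D N)
  have hG : Int.gcd D N ≠ 0 := fun h => hD (Int.gcd_eq_zero_iff.mp h).1
  have hb : (b : ℤ) ≠ 0 := by
    rintro h
    have : b = 0 := by exact_mod_cast h
    rw [this] at hab; simp at hab; exact hG hab.symm
  have hb2 : (b : ℤ) ^ 2 ≠ 0 := pow_ne_zero 2 hb
  have hbG : (b : ℤ) ^ 2 ∣ Int.gcd D N := ⟨a, by exact_mod_cast hab.symm⟩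
  obtain ⟨D', hD'⟩ := hbG.trans (Int.gcd_dvd_left D N)
  obtain ⟨N', hN'⟩ := hbG.trans (Int.gcd_dvd_right D N)
  have hx : ∀ α ∈ T, ∃ x, α.1 = b * x := by
    intro α hα
    have : (b : ℤ) ^ 2 ∣ α.1 ^ 2 := ⟨N' + D' * α.2 ^ 2, by
      have := hT α hα
      rw [hD', hN'] at this
      linear_combination this⟩
    exact (Int.pow_dvd_pow_iff two_ne_zero).mp this
  choose! x hx using hx
  have hD0 : D' ≠ 0 := by rintro rfl; exact hD (by rw [hD', mul_zero])
  have hN0 : N' ≠ 0 := by rintro rfl; exact hN (by rw [hN', mul_zero])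
  have hinj : Set.InjOn (fun α : ℤ × ℤ => (x α, α.2)) T := by
    intro α hα β hβ h
    simp only [Prod.mk.injEq] at h
    exact Prod.ext (by rw [hx α hα, hx β hβ, h.1]) h.2
  have main := card_primitive_norm_le_of_no_common_sq (D := D') (N := N') (k := k) hD0 hN0
    (abs_le_of_eq_mul hb2 hD' hDk) ?_ (T.image (fun α : ℤ × ℤ => (x α, α.2))) ?_ ?_ ?_
  · rw [Finset.card_image_of_injOn hinj] at main
    refine main.trans (Nat.mul_le_mul_left _ (card_divisors_natAbs_le_of_dvd hN ⟨b ^ 2, ?_⟩))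
    rw [hN']; ring
  · intro e h1 h2
    have h3 : (b : ℤ) ^ 2 * e ^ 2 ∣ Int.gcd D N := Int.dvd_coe_gcd
      (by rw [hD']; exact mul_dvd_mul_left _ h1) (by rw [hN']; exact mul_dvd_mul_left _ h2)
    have h4 : (Int.gcd D N : ℤ) = b ^ 2 * a := by exact_mod_cast hab.symm
    rw [h4, mul_dvd_mul_iff_left hb2] at h3
    have h5 : Squarefree (a : ℤ) := Int.squarefree_natCast.mpr ha
    exact h5 e (by rwa [← sq])
  · intro β hβ
    obtain ⟨α, hα, rfl⟩ := Finset.mem_image.mp hβ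
    apply mul_left_cancel₀ hb2
    have := hT α hα
    rw [hx α hα, hD', hN'] at this
    linear_combination this
  · intro β hβ
    obtain ⟨α, hα, rfl⟩ := Finset.mem_image.mp hβ
    exact ⟨abs_le_of_eq_mul hb (hx α hα) (hk α hα).1, (hk α hα).2⟩
  · intro β hβ
    obtain ⟨α, hα, rfl⟩ := Finset.mem_image.mp hβ
    exact (hc α hα).of_isCoprime_of_dvd_left ⟨b, by rw [hx α hα]; ring⟩

/-- Uniform bound for the number of representations of `N` by the norm form `X ^ 2 - D * Y ^ 2`
in a box. -/
theorem card_norm_le {D N : ℤ} {k : ℕ} (hD : D ≠ 0) (hN : N ≠ 0) (hDk : |D| ≤ 2 ^ k)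
    (T : Finset (ℤ × ℤ)) (hT : ∀ α ∈ T, α.1 ^ 2 - D * α.2 ^ 2 = N)
    (hk : ∀ α ∈ T, |α.1| ≤ 2 ^ k ∧ |α.2| ≤ 2 ^ k) :
    T.card ≤ (8 * k + 25) * N.natAbs.divisors.card * N.natAbs.divisors.card := by
  have hdec : ∀ α ∈ T, ∃ xy : ℤ × ℤ, α.1 = Int.gcd α.1 α.2 * xy.1 ∧
      α.2 = Int.gcd α.1 α.2 * xy.2 := by
    intro α _
    obtain ⟨x, hx⟩ := Int.gcd_dvd_left α.1 α.2
    obtain ⟨y, hy⟩ := Int.gcd_dvd_right α.1 α.2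
    exact ⟨(x, y), hx, hy⟩
  choose! f hf using hdec
  have hNf : ∀ α ∈ T, N = (Int.gcd α.1 α.2 : ℤ) ^ 2 * ((f α).1 ^ 2 - D * (f α).2 ^ 2) := by
    intro α hα
    obtain ⟨h1, h2⟩ := hf α hα
    calc N = α.1 ^ 2 - D * α.2 ^ 2 := (hT α hα).symm
      _ = (Int.gcd α.1 α.2 * (f α).1) ^ 2 - D * (Int.gcd α.1 α.2 * (f α).2) ^ 2 := by
          rw [← h1, ← h2]
      _ = _ := by ring
  -- Sort by g = gcd(X, Y): g² divides N, so at most d(N) values occur, and dividing by g makes the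
  -- points primitive.
  refine Finset.card_le_mul_card_image_of_maps_to (f := fun α => Int.gcd α.1 α.2) ?_ _ ?_
  · intro α hα
    rw [Nat.mem_divisors]
    refine ⟨Int.natCast_dvd.mp ?_, by simpa using hN⟩
    refine (Dvd.intro_left _ (sq _).symm).trans ⟨_, hNf α hα⟩
  intro g _
  rcases (T.filter (fun α => Int.gcd α.1 α.2 = g)).eq_empty_or_nonempty with h0 | ⟨α₀, hα₀⟩
  · rw [h0]; simp
  have hmem : ∀ α ∈ T.filter (fun α => Int.gcd α.1 α.2 = g), α ∈ T ∧ α.1 = g * (f α).1 ∧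
      α.2 = g * (f α).2 ∧ N = (g : ℤ) ^ 2 * ((f α).1 ^ 2 - D * (f α).2 ^ 2) := by
    intro α hα
    obtain ⟨hαT, rfl⟩ := Finset.mem_filter.mp hα
    exact ⟨hαT, (hf α hαT).1, (hf α hαT).2, hNf α hαT⟩
  set N' := (f α₀).1 ^ 2 - D * (f α₀).2 ^ 2 with hN'
  have hNN : N = (g : ℤ) ^ 2 * N' := (hmem α₀ hα₀).2.2.2
  have hN0 : N' ≠ 0 := by intro h; rw [h, mul_zero] at hNN; exact hN hNN
  have hg2 : (g : ℤ) ^ 2 ≠ 0 := by intro h; rw [h, zero_mul] at hNN; exact hN hNN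
  have hg : (g : ℤ) ≠ 0 := fun h => hg2 (by rw [h]; rfl)
  have hinj : Set.InjOn f (T.filter (fun α => Int.gcd α.1 α.2 = g)) := by
    intro α hα β hβ h
    obtain ⟨-, h1, h2, -⟩ := hmem α hα
    obtain ⟨-, h3, h4, -⟩ := hmem β hβ
    exact Prod.ext (by rw [h1, h3, h]) (by rw [h2, h4, h])
  have main := card_primitive_norm_le (N := N') (k := k) hD hN0 hDk
    ((T.filter (fun α => Int.gcd α.1 α.2 = g)).image f) ?_ ?_ ?_
  · rw [Finset.card_image_of_injOn hinj] at main
    refine main.trans (Nat.mul_le_mul_left _ (card_divisors_natAbs_le_of_dvd hN ⟨g ^ 2, ?_⟩))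
    rw [hNN]; ring
  · intro β hβ
    obtain ⟨α, hα, rfl⟩ := Finset.mem_image.mp hβ
    exact mul_left_cancel₀ hg2 ((hmem α hα).2.2.2.symm.trans hNN)
  · intro β hβ
    obtain ⟨α, hα, rfl⟩ := Finset.mem_image.mp hβ
    obtain ⟨hT', h1, h2, -⟩ := hmem α hα
    exact ⟨abs_le_of_eq_mul hg h1 (hk α hT').1, abs_le_of_eq_mul hg h2 (hk α hT').2⟩
  · intro β hβ
    obtain ⟨α, hα, rfl⟩ := Finset.mem_image.mp hβ
    obtain ⟨hT', h1, h2, -⟩ := hmem α hα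
    have hgcd : Int.gcd α.1 α.2 = g := (Finset.mem_filter.mp hα).2
    refine ⟨Int.gcdA α.1 α.2, Int.gcdB α.1 α.2, mul_left_cancel₀ hg ?_⟩
    have := Int.gcd_eq_gcd_ab α.1 α.2
    rw [hgcd] at this
    calc (g : ℤ) * (Int.gcdA α.1 α.2 * (f α).1 + Int.gcdB α.1 α.2 * (f α).2)
        = (g * (f α).1) * Int.gcdA α.1 α.2 + (g * (f α).2) * Int.gcdB α.1 α.2 := by ring
      _ = g * 1 := by rw [← h1, ← h2, mul_one]; exact this.symm

/-! ### Small solutions of linear systems off a hypersurface. -/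

theorem MvPolynomial.totalDegree_bind₁_le_of_totalDegree_le_one {σ τ : Type*}
    (φ : σ → MvPolynomial τ ℤ) (hφ : ∀ i, (φ i).totalDegree ≤ 1) (F : MvPolynomial σ ℤ) :
    (MvPolynomial.bind₁ φ F).totalDegree ≤ F.totalDegree := by
  rw [MvPolynomial.bind₁, MvPolynomial.aeval_def, MvPolynomial.eval₂_eq]
  refine MvPolynomial.totalDegree_finsetSum_le fun m hm => ?_
  refine (MvPolynomial.totalDegree_mul _ _).trans ?_
  rw [MvPolynomial.algebraMap_eq, MvPolynomial.totalDegree_C, zero_add]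
  refine (MvPolynomial.totalDegree_finsetProd _ _).trans
    (le_trans ?_ (MvPolynomial.le_totalDegree hm))
  refine Finset.sum_le_sum fun i _ => (MvPolynomial.totalDegree_pow _ _).trans ?_
  exact (Nat.mul_le_mul_left _ (hφ i)).trans (mul_one _).le

theorem MvPolynomial.exists_small_eval_ne_zero {σ : Type*} [Finite σ] {P : MvPolynomial σ ℤ}
    (hP : P ≠ 0) {d : ℕ} (hd : P.totalDegree ≤ d) :
    ∃ x : σ → ℤ, (∀ i, |x i| ≤ d) ∧ MvPolynomial.eval x P ≠ 0 := by
  by_contra! h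
  refine hP (MvPolynomial.eq_zero_of_eval_zero_at_prod_finset P
    (fun _ => Finset.Icc (0 : ℤ) d) (fun i => ?_) fun x hx => h x fun i => ?_)
  · rw [Int.card_Icc]
    have := (MvPolynomial.degreeOf_le_totalDegree P i).trans hd
    omega
  · have := Finset.mem_Icc.mp (hx i)
    exact abs_le.mpr ⟨by linarith, this.2⟩

theorem Matrix.abs_adjugate_le {ι : Type*} [Fintype ι] [DecidableEq ι] (G : Matrix ι ι ℤ) {R : ℤ}
    (hR : 1 ≤ R) (hG : ∀ i j, |G i j| ≤ R) (i j : ι) :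
    |G.adjugate i j| ≤ (Fintype.card ι).factorial * R ^ Fintype.card ι := by
  rw [Matrix.adjugate_apply]
  have := Matrix.det_le (abv := AbsoluteValue.abs) (A := G.updateRow j (Pi.single i 1)) (x := R) ?_
  · simpa using this
  · intro a b
    rw [AbsoluteValue.abs_apply, Matrix.updateRow_apply]
    split_ifs
    · rw [Pi.single_apply]
      split_ifs
      · simpa using hR
      · simp; omega
    · exact hG a b

/-- Integer vectors with small entries can be completed to a nonsingular matrix, having rows from
a basis of their span followed by standard basis vectors. -/
theorem exists_matrix_rows_spanning {ι : Type*} [Fintype ι] [DecidableEq ι] (S : Set (ι → ℤ))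
    {R : ℤ} (hR : 1 ≤ R) (hS : ∀ s ∈ S, ∀ i, |s i| ≤ R) :
    ∃ (G : Matrix ι ι ℤ) (J : Set ι), G.det ≠ 0 ∧ (∀ i j, |G i j| ≤ R) ∧
      (∀ j ∈ J, G j ∈ S) ∧
      ∀ x : ι → ℤ, (∀ j ∈ J, G j ⬝ᵥ x = 0) → ∀ s ∈ S, s ⬝ᵥ x = 0 := by
  classical
  let v : (ι → ℤ) → (ι → ℚ) := fun s i => (s i : ℚ)
  obtain ⟨b₁, hb₁S, -, hspan₁, hli₁⟩ :=
    exists_linearIndepOn_extension (K := ℚ) (v := v) (linearIndepOn_empty ℚ v) (Set.empty_subset S)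
  -- The basis `b₁` of the span of S is enlarged to a basis of the whole space by standard vectors,
  -- whose entries do not exceed `R`.
  obtain ⟨b₂, hb₂, hb₁₂, hspan₂, hli₂⟩ :=
    exists_linearIndepOn_extension (K := ℚ) (v := v) hli₁
      (Set.subset_union_left (t := Set.range fun i : ι => (Pi.single i 1 : ι → ℤ)))
  have htop : ⊤ ≤ Submodule.span ℚ (Set.range fun x : b₂ => v x) := by
    have h1 : Set.range (fun x : b₂ => v x) = v '' b₂ := by
      rw [Set.image_eq_range]
    rw [h1]
    have h2 : Submodule.span ℚ (Set.range (Pi.basisFun ℚ ι)) ≤ Submodule.span ℚ (v '' b₂) := by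
      rw [Submodule.span_le]
      rintro _ ⟨i, rfl⟩
      refine hspan₂ ⟨Pi.single i 1, Or.inr ⟨i, rfl⟩, ?_⟩
      ext j
      simp only [v, Pi.basisFun_apply, Pi.single_apply]
      split_ifs <;> simp
    rwa [(Pi.basisFun ℚ ι).span_eq] at h2
  let B : Module.Basis b₂ ℚ (ι → ℚ) := Module.Basis.mk hli₂ htop
  let e : ι ≃ b₂ := (Pi.basisFun ℚ ι).indexEquiv B
  let G : Matrix ι ι ℤ := Matrix.of fun i => (e i : ι → ℤ)
  refine ⟨G, {j | (e j : ι → ℤ) ∈ b₁}, ?_, ?_, fun j hj => hb₁S hj, ?_⟩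
  · have h1 : LinearIndependent ℚ (G.map (Int.castRingHom ℚ)).row := by
      have := hli₂.linearIndependent.comp e e.injective
      exact this
    rw [Matrix.linearIndependent_rows_iff_isUnit, Matrix.isUnit_iff_isUnit_det,
      ← RingHom.mapMatrix_apply, ← RingHom.map_det] at h1
    intro h
    rw [h] at h1
    simp at h1
  · intro i j
    rcases hb₂ (e i).2 with h | ⟨k, hk⟩
    · exact hS _ (hb₁S h) j
    · have : G i j = (Pi.single k 1 : ι → ℤ) j := (congrFun hk j).symm
      rw [this, Pi.single_apply]
      split_ifs
      · simpa using hR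
      · simp; omega
  · intro x hx s hs
    have h4 : v s ⬝ᵥ v x = 0 := by
      refine Submodule.span_induction (p := fun y _ => y ⬝ᵥ v x = 0) ?_ (zero_dotProduct _)
        (fun y z _ _ hy hz => by rw [add_dotProduct, hy, hz, add_zero])
        (fun r y _ hy => by rw [smul_dotProduct, hy, smul_zero]) (hspan₁ ⟨s, hs, rfl⟩)
      rintro _ ⟨t, ht, rfl⟩
      have := hx (e.symm ⟨t, hb₁₂ ht⟩) (by simpa using ht)
      have h5 : G (e.symm ⟨t, hb₁₂ ht⟩) = t := by
        change ((e (e.symm ⟨t, hb₁₂ ht⟩) : b₂) : ι → ℤ) = t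
        rw [Equiv.apply_symm_apply]
      have h3 : t ⬝ᵥ x = 0 := by rwa [h5] at this
      simp only [dotProduct, v] at h3 ⊢
      exact_mod_cast h3
    simp only [dotProduct, v] at h4 ⊢
    exact_mod_cast h4

/-- If some integer solution of a homogeneous linear system avoids the zero set of a polynomial,
also after scaling, then some small solution does. -/
theorem exists_small_solution_eval_ne_zero {ι : Type*} [Fintype ι] [DecidableEq ι]
    (F : MvPolynomial ι ℤ) :
    ∃ K : ℕ, ∀ (S : Set (ι → ℤ)) (R : ℤ), 1 ≤ R → (∀ s ∈ S, ∀ i, |s i| ≤ R) →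
      ∀ q : ι → ℤ, (∀ s ∈ S, s ⬝ᵥ q = 0) →
      (∀ m : ℤ, m ≠ 0 → MvPolynomial.eval (m • q) F ≠ 0) →
      ∃ q' : ι → ℤ, (∀ s ∈ S, s ⬝ᵥ q' = 0) ∧ MvPolynomial.eval q' F ≠ 0 ∧
        ∀ i, |q' i| ≤ K * R ^ Fintype.card ι := by
  classical
  refine ⟨Fintype.card ι * ((Fintype.card ι).factorial * F.totalDegree), ?_⟩
  intro S R hR hS q hq hF
  obtain ⟨G, J, hdet, hGR, hJ, hJS⟩ := exists_matrix_rows_spanning S hR hS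
  let mask : (ι → ℤ) → ι → ℤ := fun μ j => if j ∈ J then 0 else μ j
  -- Vectors adj(G) μ with μ zero on `J` solve the system, since G adj(G) μ = det(G) μ. This
  -- parametrises solutions linearly with controlled coefficients.
  let φ : ι → MvPolynomial ι ℤ := fun i =>
    ∑ j, MvPolynomial.C (G.adjugate i j * if j ∈ J then 0 else 1) * MvPolynomial.X j
  have hφd : ∀ i, (φ i).totalDegree ≤ 1 := fun i =>
    MvPolynomial.totalDegree_finsetSum_le fun j _ =>
      (MvPolynomial.totalDegree_mul _ _).trans
        (by rw [MvPolynomial.totalDegree_C, MvPolynomial.totalDegree_X])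
  have heval : ∀ μ, MvPolynomial.eval μ (MvPolynomial.bind₁ φ F) =
      MvPolynomial.eval (G.adjugate.mulVec (mask μ)) F := by
    intro μ
    have h1 : (fun i => MvPolynomial.eval μ (φ i)) = G.adjugate.mulVec (mask μ) := by
      ext i
      simp only [φ, map_sum, map_mul, MvPolynomial.eval_C, MvPolynomial.eval_X, Matrix.mulVec,
        dotProduct, mask]
      refine Finset.sum_congr rfl fun j _ => ?_
      split_ifs <;> ring
    rw [← h1, MvPolynomial.eval, MvPolynomial.eval₂Hom_bind₁]
    rfl
  have hmaskq : mask (G.mulVec q) = G.mulVec q := by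
    ext j
    simp only [mask]
    split_ifs with h
    · exact (hq _ (hJ j h)).symm
    · rfl
  -- The parameter μ = G q gives adj(G) G q = det(G) q, where `F` does not vanish; this is why the
  -- hypothesis on `F` covers all multiples of q.
  have hne : MvPolynomial.bind₁ φ F ≠ 0 := by
    intro h
    have := heval (G.mulVec q)
    rw [h, map_zero, hmaskq, Matrix.mulVec_mulVec, Matrix.adjugate_mul, Matrix.smul_mulVec,
      Matrix.one_mulVec] at this
    exact hF _ hdet this.symm
  obtain ⟨μ, hμ, hμF⟩ := MvPolynomial.exists_small_eval_ne_zero hne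
    (MvPolynomial.totalDegree_bind₁_le_of_totalDegree_le_one φ hφd F)
  refine ⟨G.adjugate.mulVec (mask μ), hJS _ fun j hj => ?_, by rwa [← heval], fun i => ?_⟩
  · change G.mulVec (G.adjugate.mulVec (mask μ)) j = 0
    rw [Matrix.mulVec_mulVec, Matrix.mul_adjugate, Matrix.smul_mulVec, Matrix.one_mulVec]
    simp [mask, hj]
  · have hR0 : 0 ≤ R := by omega
    calc |(G.adjugate.mulVec (mask μ)) i| ≤ ∑ j, |G.adjugate i j * mask μ j| :=
          Finset.abs_sum_le_sum_abs _ _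
      _ ≤ ∑ _j : ι, ((Fintype.card ι).factorial * R ^ Fintype.card ι) * (F.totalDegree : ℤ) := by
          refine Finset.sum_le_sum fun j _ => ?_
          rw [abs_mul]
          refine mul_le_mul (Matrix.abs_adjugate_le G hR hGR i j) ?_ (abs_nonneg _) (by positivity)
          simp only [mask]
          split_ifs
          · simp
          · exact hμ j
      _ = _ := by
          rw [Finset.sum_const, Finset.card_univ]
          push_cast
          rw [nsmul_eq_mul]
          ring

/-! ### Uniform bounds for conics. -/

theorem exists_card_norm_le_rpow (ε : ℝ) (hε : 0 < ε) :
    ∃ C : ℝ, 0 < C ∧ ∀ (Z : ℕ) (D N : ℤ), 1 ≤ Z → D ≠ 0 → N ≠ 0 → |D| ≤ Z → |N| ≤ Z →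
      ∀ T : Finset (ℤ × ℤ), (∀ α ∈ T, α.1 ^ 2 - D * α.2 ^ 2 = N) →
      (∀ α ∈ T, |α.1| ≤ Z ∧ |α.2| ≤ Z) → (T.card : ℝ) ≤ C * (Z : ℝ) ^ ε := by
  -- One share for each of the two divisor counts and one for the logarithm.
  set δ := ε / 3 with hδ
  have hδ0 : 0 < δ := by positivity
  obtain ⟨C₁, hC₁, hdiv⟩ := exists_card_divisors_le_rpow δ hδ0
  have hl : 0 < Real.log 2 := Real.log_pos (by norm_num)
  refine ⟨(8 / (δ * Real.log 2) + 33) * (C₁ * C₁), by positivity, ?_⟩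
  intro Z D N hZ hD hN hDZ hNZ T hT hTZ
  have hZr : (1 : ℝ) ≤ Z := by exact_mod_cast hZ
  set m := Nat.log 2 Z with hm
  have h2 : (2 : ℕ) ^ m ≤ Z := Nat.pow_log_le_self 2 (by omega)
  have h3 : Z ≤ 2 ^ (m + 1) := (Nat.lt_pow_succ_log_self (by norm_num) Z).le
  have h3' : (Z : ℤ) ≤ 2 ^ (m + 1) := by exact_mod_cast h3
  have main := card_norm_le hD hN (hDZ.trans h3') T hT
    (fun α hα => ⟨(hTZ α hα).1.trans h3', (hTZ α hα).2.trans h3'⟩)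
  have hd : (N.natAbs.divisors.card : ℝ) ≤ C₁ * (Z : ℝ) ^ δ := by
    refine (hdiv _ (by simpa using hN)).trans ?_
    have h4 : ((N.natAbs : ℕ) : ℝ) ≤ Z := by
      have : N.natAbs ≤ Z := by zify; exact hNZ
      exact_mod_cast this
    gcongr
  have hmZ : (m : ℝ) * (δ * Real.log 2) ≤ (Z : ℝ) ^ δ := by
    have h4 : ((2 : ℝ) ^ m) ^ δ ≤ (Z : ℝ) ^ δ := by
      have : (2 : ℝ) ^ m ≤ Z := by exact_mod_cast h2
      gcongr
    refine le_trans ?_ h4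
    rw [← Real.rpow_natCast, ← Real.rpow_mul (by norm_num), Real.rpow_def_of_pos (by norm_num)]
    have := Real.add_one_le_exp (Real.log 2 * (m * δ))
    linarith
  have hZδ : 1 ≤ (Z : ℝ) ^ δ := Real.one_le_rpow hZr hδ0.le
  have hlin : (8 * (m + 1 : ℕ) + 25 : ℝ) ≤ (8 / (δ * Real.log 2) + 33) * (Z : ℝ) ^ δ := by
    have h5 : (m : ℝ) ≤ (Z : ℝ) ^ δ / (δ * Real.log 2) := by
      rw [le_div_iff₀ (by positivity)]; exact hmZ
    have h6 : 8 / (δ * Real.log 2) * (Z : ℝ) ^ δ = 8 * ((Z : ℝ) ^ δ / (δ * Real.log 2)) := by ring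
    push_cast
    rw [add_mul, h6]
    linarith
  have h7 : (Z : ℝ) ^ ε = (Z : ℝ) ^ δ * (Z : ℝ) ^ δ * (Z : ℝ) ^ δ := by
    rw [← Real.rpow_add (by positivity), ← Real.rpow_add (by positivity)]
    congr 1; rw [hδ]; ring
  calc (T.card : ℝ) ≤ (8 * (m + 1 : ℕ) + 25) * N.natAbs.divisors.card * N.natAbs.divisors.card := by
        exact_mod_cast main
    _ ≤ ((8 / (δ * Real.log 2) + 33) * (Z : ℝ) ^ δ) * (C₁ * (Z : ℝ) ^ δ) * (C₁ * (Z : ℝ) ^ δ) := by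
        gcongr
    _ = _ := by rw [h7]; ring

theorem abs_mul_le_mul_of_abs_le {y z Y Z : ℤ} (h1 : |y| ≤ Y) (h2 : |z| ≤ Z) :
    |y * z| ≤ Y * Z := by
  rw [abs_mul]
  exact mul_le_mul h1 h2 (abs_nonneg _) ((abs_nonneg _).trans h1)

/-- The number of integer zeros of a conic in a box, in terms of the size of its coefficients. -/
theorem exists_card_conic_zeros_le_rpow_height (ε : ℝ) (hε : 0 < ε) :
    ∃ C : ℝ, 0 < C ∧ ∀ (q : Fin 6 → ℤ) (M : ℕ), 1 ≤ M → (∀ i, |q i| ≤ M) →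
      q 1 ^ 2 - 4 * q 0 * q 2 ≠ 0 →
      (q 1 * q 3 - 2 * q 0 * q 4) ^ 2 -
        (q 1 ^ 2 - 4 * q 0 * q 2) * (q 3 ^ 2 - 4 * q 0 * q 5) ≠ 0 →
      ∀ T : Finset (ℤ × ℤ), (∀ α ∈ T, |α.1| ≤ M ∧ |α.2| ≤ M) →
      (∀ α ∈ T, q 0 * α.1 ^ 2 + q 1 * (α.1 * α.2) + q 2 * α.2 ^ 2 + q 3 * α.1 + q 4 * α.2 + q 5
        = 0) → (T.card : ℝ) ≤ C * (M : ℝ) ^ ε := by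
  classical
  obtain ⟨C, hC, hnorm⟩ := exists_card_norm_le_rpow (ε / 4) (by positivity)
  refine ⟨C * 34 ^ (ε / 4), by positivity, ?_⟩
  intro q M hM hq hD0 hN0 T hTL hT
  set D := q 1 ^ 2 - 4 * q 0 * q 2 with hDdef
  set N := (q 1 * q 3 - 2 * q 0 * q 4) ^ 2 - D * (q 3 ^ 2 - 4 * q 0 * q 5) with hNdef
  -- With q 0 = 0 one has D = (q 1)², and the two terms of N cancel.
  have ha0 : q 0 ≠ 0 := by
    intro h
    apply hN0
    rw [hNdef, hDdef, h]; ring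
  have hM1 : (1 : ℤ) ≤ M := by exact_mod_cast hM
  have hqq : ∀ i j, |q i * q j| ≤ (M : ℤ) * M := fun i j => abs_mul_le_mul_of_abs_le (hq i) (hq j)
  have hE : |q 1 * q 3 - 2 * q 0 * q 4| ≤ 3 * ((M : ℤ) * M) := by
    have h1 := abs_le.mp (hqq 1 3)
    have h2 := abs_le.mp (hqq 0 4)
    rw [abs_le]; constructor <;> linarith
  have hdisc : ∀ i j k, |q i ^ 2 - 4 * q j * q k| ≤ 5 * ((M : ℤ) * M) := by
    intro i j k
    have h1 := abs_le.mp (hqq i i)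
    have h2 := abs_le.mp (hqq j k)
    rw [abs_le]; constructor <;> linarith
  have hM2 : (M : ℤ) ≤ M * M := le_mul_of_one_le_left (by positivity) hM1
  have hM3 : (M : ℤ) * M ≤ M * M * M := le_mul_of_one_le_right (by positivity) hM1
  have hM4 : (M : ℤ) * M * M ≤ M * M * M * M := le_mul_of_one_le_right (by positivity) hM1
  -- 34 = 3² + 5 · 5, from the bounds 3M² and 5M² on the ingredients of N.
  have hZM : ((34 * M ^ 4 : ℕ) : ℤ) = 34 * (M * M * M * M) := by push_cast; ring
  have hDZ : |D| ≤ (34 * M ^ 4 : ℕ) := by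
    rw [hZM]
    exact (hdisc 1 0 2).trans (by linarith)
  have hNZ : |N| ≤ (34 * M ^ 4 : ℕ) := by
    rw [hZM]
    have h1 := abs_le.mp (abs_mul_le_mul_of_abs_le hE hE)
    have h2 := abs_le.mp (abs_mul_le_mul_of_abs_le (hdisc 1 0 2) (hdisc 3 0 5))
    rw [abs_le]; constructor <;> linarith
  -- Completing the square: X = D y + (bd - 2ae) and Y = 2ax + by + d satisfy X² - D Y² = N on the
  -- conic.
  let g : ℤ × ℤ → ℤ × ℤ := fun α =>
    (D * α.2 + (q 1 * q 3 - 2 * q 0 * q 4), 2 * q 0 * α.1 + q 1 * α.2 + q 3)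
  have hginj : Function.Injective g := by
    intro α β h
    simp only [g, Prod.mk.injEq] at h
    have h2 : α.2 = β.2 := mul_left_cancel₀ hD0 (by linarith [h.1])
    have h1 : α.1 = β.1 := by
      have := h.2
      rw [h2] at this
      exact mul_left_cancel₀ (mul_ne_zero two_ne_zero ha0) (by linarith)
    exact Prod.ext h1 h2
  have main := hnorm (34 * M ^ 4) D N (by nlinarith [pow_pos (Nat.lt_of_lt_of_le Nat.zero_lt_one hM) 4])
    hD0 hN0 hDZ hNZ (T.image g) ?_ ?_
  · rw [Finset.card_image_of_injective _ hginj] at main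
    refine main.trans (le_of_eq ?_)
    have hcast : ((34 * M ^ 4 : ℕ) : ℝ) = 34 * (M : ℝ) ^ (4 : ℝ) := by
      push_cast
      rw [show (4 : ℝ) = ((4 : ℕ) : ℝ) by norm_num, Real.rpow_natCast]
    rw [hcast, Real.mul_rpow (by positivity) (by positivity), ← Real.rpow_mul (by positivity),
      mul_div_cancel₀ ε (by norm_num : (4 : ℝ) ≠ 0), mul_assoc]
  · intro β hβ
    obtain ⟨α, hα, rfl⟩ := Finset.mem_image.mp hβ
    have h1 := hT α hα
    simp only [g]
    rw [hNdef, hDdef]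
    linear_combination (-4 * q 0 * (q 1 ^ 2 - 4 * q 0 * q 2)) * h1
  · intro β hβ
    obtain ⟨α, hα, rfl⟩ := Finset.mem_image.mp hβ
    obtain ⟨h1, h2⟩ := hTL α hα
    simp only [g]
    rw [hZM]
    have k1 := abs_le.mp (abs_mul_le_mul_of_abs_le (hdisc 1 0 2) h2)
    have k2 := abs_le.mp hE
    have k3 := abs_le.mp (abs_mul_le_mul_of_abs_le (hq 0) h1)
    have k4 := abs_le.mp (abs_mul_le_mul_of_abs_le (hq 1) h2)
    have k5 := abs_le.mp (hq 3)
    constructor <;> rw [abs_le] <;> constructor <;> linarith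

/-- The number of integer zeros of a conic in a box, uniformly in its coefficients. -/
theorem exists_card_conic_zeros_le_rpow (ε : ℝ) (hε : 0 < ε) :
    ∃ C : ℝ, 0 < C ∧ ∀ (a b c d e f : ℤ) (L : ℕ), 1 ≤ L → b ^ 2 - 4 * a * c ≠ 0 →
      (b * d - 2 * a * e) ^ 2 - (b ^ 2 - 4 * a * c) * (d ^ 2 - 4 * a * f) ≠ 0 →
      ∀ T : Finset (ℤ × ℤ), (∀ α ∈ T, |α.1| ≤ L ∧ |α.2| ≤ L) →
      (∀ α ∈ T, a * α.1 ^ 2 + b * (α.1 * α.2) + c * α.2 ^ 2 + d * α.1 + e * α.2 + f = 0) →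
      (T.card : ℝ) ≤ C * (L : ℝ) ^ ε := by
  classical
  let x : Fin 6 → MvPolynomial (Fin 6) ℤ := MvPolynomial.X
  -- The product of the two quantities that must stay nonzero; it is homogeneous of degree 6, so
  -- scaling the coefficients keeps it nonzero.
  let F : MvPolynomial (Fin 6) ℤ := (x 1 ^ 2 - 4 * x 0 * x 2) *
    ((x 1 * x 3 - 2 * x 0 * x 4) ^ 2 - (x 1 ^ 2 - 4 * x 0 * x 2) * (x 3 ^ 2 - 4 * x 0 * x 5))
  have hFe : ∀ q : Fin 6 → ℤ, MvPolynomial.eval q F = (q 1 ^ 2 - 4 * q 0 * q 2) *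
    ((q 1 * q 3 - 2 * q 0 * q 4) ^ 2 - (q 1 ^ 2 - 4 * q 0 * q 2) * (q 3 ^ 2 - 4 * q 0 * q 5)) := by
    intro q; simp [F, x]
  clear_value F
  obtain ⟨K, hK⟩ := exists_small_solution_eval_ne_zero F
  obtain ⟨C, hC, hconic⟩ := exists_card_conic_zeros_le_rpow_height (ε / 12) (by positivity)
  -- The 6 monomials have size at most L² at the points, so the new coefficients are O((L²)^6) =
  -- O(L^12); hence ε / 12.
  refine ⟨C * ((K : ℝ) + 1) ^ (ε / 12), by positivity, ?_⟩
  intro a b c d e f L hL hD hN T hTL hT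
  let w : ℤ × ℤ → Fin 6 → ℤ := fun α => ![α.1 ^ 2, α.1 * α.2, α.2 ^ 2, α.1, α.2, 1]
  have hwdot : ∀ α (q : Fin 6 → ℤ), w α ⬝ᵥ q = q 0 * α.1 ^ 2 + q 1 * (α.1 * α.2) + q 2 * α.2 ^ 2 +
      q 3 * α.1 + q 4 * α.2 + q 5 := by
    intro α q
    simp [w, dotProduct, Fin.sum_univ_six]
    ring
  have hL' : (1 : ℤ) ≤ L := by exact_mod_cast hL
  have hw : ∀ s ∈ w '' T, ∀ i, |s i| ≤ (L : ℤ) ^ 2 := by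
    rintro _ ⟨α, hα, rfl⟩ i
    obtain ⟨h1, h2⟩ := hTL α hα
    have k4 : (L : ℤ) ≤ (L : ℤ) * L := le_mul_of_one_le_left (by positivity) hL'
    rw [sq]
    fin_cases i
    · simpa [w, sq] using abs_mul_le_mul_of_abs_le h1 h1
    · simpa [w] using abs_mul_le_mul_of_abs_le h1 h2
    · simpa [w, sq] using abs_mul_le_mul_of_abs_le h2 h2
    · exact h1.trans k4
    · exact h2.trans k4
    · exact abs_one.le.trans (hL'.trans k4)
  have hzero : ∀ s ∈ w '' T, s ⬝ᵥ ![a, b, c, d, e, f] = 0 := by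
    rintro _ ⟨α, hα, rfl⟩
    rw [hwdot]
    exact hT α hα
  have hF : ∀ m : ℤ, m ≠ 0 → MvPolynomial.eval (m • ![a, b, c, d, e, f]) F ≠ 0 := by
    intro m hm
    have : m ^ 6 * ((b ^ 2 - 4 * a * c) *
      ((b * d - 2 * a * e) ^ 2 - (b ^ 2 - 4 * a * c) * (d ^ 2 - 4 * a * f))) ≠ 0 :=
      mul_ne_zero (pow_ne_zero _ hm) (mul_ne_zero hD hN)
    have e1 : MvPolynomial.eval (m • ![a, b, c, d, e, f]) F = ((m * b) ^ 2 - 4 * (m * a) * (m * c)) *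
      ((m * b * (m * d) - 2 * (m * a) * (m * e)) ^ 2 - ((m * b) ^ 2 - 4 * (m * a) * (m * c)) *
        ((m * d) ^ 2 - 4 * (m * a) * (m * f))) := hFe _
    rw [e1]
    convert! this using 1
    ring
  obtain ⟨q, hqS, hqF, hqb⟩ := hK (w '' T) ((L : ℤ) ^ 2) (one_le_pow₀ hL') hw
    ![a, b, c, d, e, f] hzero hF
  rw [hFe] at hqF
  have hL12 : (1 : ℤ) ≤ (L : ℤ) ^ 12 := one_le_pow₀ hL'
  have hLM : (L : ℤ) ≤ ((K + 1) * L ^ 12 : ℕ) := by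
    have : (L : ℤ) ≤ (L : ℤ) ^ 12 := le_self_pow₀ hL' (by norm_num)
    push_cast
    nlinarith [Int.natCast_nonneg K]
  have hq : ∀ i, |q i| ≤ ((K + 1) * L ^ 12 : ℕ) := by
    intro i
    refine (hqb i).trans ?_
    have : ((L : ℤ) ^ 2) ^ Fintype.card (Fin 6) = (L : ℤ) ^ 12 := by
      rw [Fintype.card_fin, ← pow_mul]
    rw [this]
    push_cast
    linarith
  have main := hconic q ((K + 1) * L ^ 12) (by exact_mod_cast hL'.trans hLM) hq
    (left_ne_zero_of_mul hqF) (right_ne_zero_of_mul hqF) T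
    (fun α hα => ⟨(hTL α hα).1.trans hLM, (hTL α hα).2.trans hLM⟩)
    (fun α hα => by rw [← hwdot]; exact hqS _ ⟨α, hα, rfl⟩)
  refine main.trans (le_of_eq ?_)
  have hcast : (((K + 1) * L ^ 12 : ℕ) : ℝ) = ((K : ℝ) + 1) * (L : ℝ) ^ (12 : ℝ) := by
    push_cast
    rw [show (12 : ℝ) = ((12 : ℕ) : ℝ) by norm_num, Real.rpow_natCast]
  rw [hcast, Real.mul_rpow (by positivity) (by positivity), ← Real.rpow_mul (by positivity),
    mul_div_cancel₀ ε (by norm_num : (12 : ℝ) ≠ 0), mul_assoc]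

/-! ### Degenerate conics and slicing by planes. -/

theorem card_quadratic_roots_le_two {a b c : ℤ} (ha : a ≠ 0) (T : Finset ℤ)
    (hT : ∀ x ∈ T, a * x ^ 2 + b * x + c = 0) : T.card ≤ 2 := by
  by_contra! h
  obtain ⟨x, hx, y, hy, z, hz, hxy, hxz, hyz⟩ := Finset.two_lt_card.mp h
  have h1 : a * (x + y) + b = 0 := mul_left_cancel₀ (sub_ne_zero.mpr hxy)
    (by linear_combination hT x hx - hT y hy)
  have h2 : a * (x + z) + b = 0 := mul_left_cancel₀ (sub_ne_zero.mpr hxz)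
    (by linear_combination hT x hx - hT z hz)
  exact mul_ne_zero ha (sub_ne_zero.mpr hyz) (by linear_combination h1 - h2)

theorem card_conic_zeros_le {a b c d e f : ℤ} (ha : a ≠ 0) (L : ℕ) (T : Finset (ℤ × ℤ))
    (hTL : ∀ α ∈ T, 0 ≤ α.2 ∧ α.2 ≤ L)
    (hT : ∀ α ∈ T, a * α.1 ^ 2 + b * (α.1 * α.2) + c * α.2 ^ 2 + d * α.1 + e * α.2 + f = 0) :
    T.card ≤ 2 * (L + 1) := by
  have h1 : (Finset.Icc (0 : ℤ) L).card = L + 1 := by rw [Int.card_Icc]; omega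
  rw [← h1]
  refine Finset.card_le_mul_card_image_of_maps_to (f := Prod.snd)
    (fun α hα => Finset.mem_Icc.mpr (hTL α hα)) 2 fun y _ => ?_
  have hinj : Set.InjOn Prod.fst (T.filter fun α => α.2 = y : Set (ℤ × ℤ)) := by
    intro α hα β hβ h
    simp only [Finset.coe_filter, Set.mem_ofPred_eq] at hα hβ
    exact Prod.ext h (hα.2.trans hβ.2.symm)
  rw [← Finset.card_image_of_injOn hinj]
  refine card_quadratic_roots_le_two (b := b * y + d) (c := c * y ^ 2 + e * y + f) ha _ ?_
  intro x hx
  obtain ⟨α, hα, rfl⟩ := Finset.mem_image.mp hx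
  obtain ⟨hαT, rfl⟩ := Finset.mem_filter.mp hα
  linear_combination hT α hαT

/-- Here the completed square reads X² = D Y². As D is not a square, X = Y = 0, and these two
independent linear equations have at most one common zero. -/
theorem card_conic_zeros_le_one {a b c d e f : ℤ} (ha : a ≠ 0)
    (hD : ¬ IsSquare (b ^ 2 - 4 * a * c))
    (hN : (b * d - 2 * a * e) ^ 2 - (b ^ 2 - 4 * a * c) * (d ^ 2 - 4 * a * f) = 0)
    (T : Finset (ℤ × ℤ))
    (hT : ∀ α ∈ T, a * α.1 ^ 2 + b * (α.1 * α.2) + c * α.2 ^ 2 + d * α.1 + e * α.2 + f = 0) :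
    T.card ≤ 1 := by
  have hD0 : b ^ 2 - 4 * a * c ≠ 0 := fun h => hD (by rw [h]; exact IsSquare.zero)
  have key : ∀ α ∈ T, 2 * a * α.1 + b * α.2 + d = 0 ∧
      (b ^ 2 - 4 * a * c) * α.2 + (b * d - 2 * a * e) = 0 := by
    intro α hα
    have h : ((b ^ 2 - 4 * a * c) * α.2 + (b * d - 2 * a * e)) ^ 2 =
        (b ^ 2 - 4 * a * c) * (2 * a * α.1 + b * α.2 + d) ^ 2 := by
      linear_combination hN - 4 * a * (b ^ 2 - 4 * a * c) * hT α hα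
    have hX : 2 * a * α.1 + b * α.2 + d = 0 := by
      by_contra hX
      have hdvd : 2 * a * α.1 + b * α.2 + d ∣
          (b ^ 2 - 4 * a * c) * α.2 + (b * d - 2 * a * e) :=
        (Int.pow_dvd_pow_iff two_ne_zero).mp (by rw [h]; exact dvd_mul_left _ _)
      obtain ⟨m, hm⟩ := hdvd
      rw [hm] at h
      exact hD ⟨m, mul_left_cancel₀ (pow_ne_zero 2 hX) (by linear_combination -h)⟩
    refine ⟨hX, ?_⟩
    rw [hX] at h
    exact pow_eq_zero_iff two_ne_zero |>.mp (by linarith)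
  rw [Finset.card_le_one]
  intro α hα β hβ
  obtain ⟨h1, h2⟩ := key α hα
  obtain ⟨h3, h4⟩ := key β hβ
  have e2 : α.2 = β.2 := mul_left_cancel₀ hD0 (by linarith)
  refine Prod.ext (mul_left_cancel₀ (mul_ne_zero two_ne_zero ha) ?_) e2
  rw [e2] at h1
  linarith

theorem MvPolynomial.card_zeros_mul_le {n : ℕ} {p : MvPolynomial (Fin n) ℤ} (hp : p ≠ 0)
    (S : Finset ℤ) :
    ((Fintype.piFinset fun _ : Fin n => S).filter fun x => MvPolynomial.eval x p = 0).card * S.card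
      ≤ p.totalDegree * S.card ^ n := by
  rcases S.eq_empty_or_nonempty with rfl | hS
  · simp
  have h := MvPolynomial.schwartz_zippel_totalDegree hp S
  have h0 : (0 : ℚ≥0) < S.card := by exact_mod_cast hS.card_pos
  rw [div_le_div_iff₀ (by positivity) h0] at h
  exact_mod_cast h

/-- A point count is controlled by the counts on the fibres of translates by the lattice spanned
by two vectors. -/
theorem card_mul_sq_le_sum_card_fibres {n : ℕ} (u v : Fin n → ℤ) (L : ℕ) (hu : ∀ i, |u i| ≤ 2)
    (hv : ∀ i, |v i| ≤ 2) (T : Finset (Fin n → ℤ)) (hT : ∀ t ∈ T, ∀ i, |t i| ≤ L) :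
    T.card * (L + 1) ^ 2 ≤ ∑ s ∈ Fintype.piFinset fun _ : Fin n => Finset.Icc (-(5 * L : ℤ)) (5 * L),
      ((Finset.Icc (0 : ℤ) L ×ˢ Finset.Icc (0 : ℤ) L).filter
        fun α => s - α.1 • u - α.2 • v ∈ T).card := by
  classical
  set I := Finset.Icc (0 : ℤ) L with hI
  have hIc : I.card = L + 1 := by rw [hI, Int.card_Icc]; omega
  have h1 : T.card * (L + 1) ^ 2 = (T ×ˢ (I ×ˢ I)).card := by
    rw [Finset.card_product, Finset.card_product, hIc, sq]
  -- Group the triples (t, x, y) by s = t + x u + y v, whose entries are at most L + 2L + 2L = 5L in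
  -- absolute value.
  rw [h1, Finset.card_eq_sum_card_fiberwise (f := fun x => x.1 + x.2.1 • u + x.2.2 • v)
    (t := Fintype.piFinset fun _ : Fin n => Finset.Icc (-(5 * L : ℤ)) (5 * L))]
  · refine Finset.sum_le_sum fun s _ => Finset.card_le_card_of_injOn Prod.snd ?_ ?_
    · rintro ⟨t, α⟩ hx
      simp only [Finset.coe_filter, Finset.mem_product, Set.mem_ofPred_eq] at hx ⊢
      obtain ⟨⟨ht, hα⟩, rfl⟩ := hx
      refine ⟨hα, ?_⟩
      convert! ht using 1
      abel
    · rintro ⟨t, α⟩ hx ⟨t', α'⟩ hx' (rfl : α = α')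
      simp only [Finset.coe_filter, Finset.mem_product, Set.mem_ofPred_eq] at hx hx'
      have := hx.2.trans hx'.2.symm
      simpa using this
  · rintro ⟨t, x, y⟩ h
    simp only [Finset.coe_product, Set.mem_prod, Finset.mem_coe, hI, Finset.mem_Icc] at h
    obtain ⟨ht, ⟨hx0, hx⟩, hy0, hy⟩ := h
    rw [Finset.mem_coe, Fintype.mem_piFinset]
    intro i
    rw [Finset.mem_Icc, ← abs_le]
    have k1 : |x * u i| ≤ L * 2 := abs_mul_le_mul_of_abs_le (by rwa [abs_of_nonneg hx0]) (hu i)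
    have k2 : |y * v i| ≤ L * 2 := abs_mul_le_mul_of_abs_le (by rwa [abs_of_nonneg hy0]) (hv i)
    have k0 := hT t ht i
    rw [abs_le] at k0 k1 k2 ⊢
    simp only [Pi.add_apply, Pi.smul_apply, smul_eq_mul]
    constructor <;> linarith

/-- The discriminant of the conics cut out by a quadratic polynomial `p` on the translates of a
plane, as a function of the translation; `a, b, c` are the coefficients of their quadratic parts
and `d, e` those of their linear parts. -/
noncomputable def fibreDiscriminant {n : ℕ} (p d e : MvPolynomial (Fin n) ℤ) (a b c : ℤ) :
    MvPolynomial (Fin n) ℤ :=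
  (MvPolynomial.C b * d - MvPolynomial.C (2 * a) * e) ^ 2 -
    MvPolynomial.C (b ^ 2 - 4 * a * c) * (d ^ 2 - MvPolynomial.C (4 * a) * p)

theorem eval_fibreDiscriminant {n : ℕ} (p d e : MvPolynomial (Fin n) ℤ) (a b c : ℤ)
    (s : Fin n → ℤ) : MvPolynomial.eval s (fibreDiscriminant p d e a b c) =
      (b * MvPolynomial.eval s d - 2 * a * MvPolynomial.eval s e) ^ 2 -
        (b ^ 2 - 4 * a * c) * (MvPolynomial.eval s d ^ 2 - 4 * a * MvPolynomial.eval s p) := by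
  simp only [fibreDiscriminant, map_sub, map_mul, map_pow, MvPolynomial.eval_C]

theorem MvPolynomial.totalDegree_C_mul_le {n : ℕ} (a : ℤ) (p : MvPolynomial (Fin n) ℤ) :
    (MvPolynomial.C a * p).totalDegree ≤ p.totalDegree :=
  (MvPolynomial.totalDegree_mul _ _).trans (by rw [MvPolynomial.totalDegree_C, zero_add])

theorem totalDegree_fibreDiscriminant_le {n : ℕ} {p d e : MvPolynomial (Fin n) ℤ} (a b c : ℤ)
    (hp : p.totalDegree ≤ 2) (hd : d.totalDegree ≤ 1) (he : e.totalDegree ≤ 1) :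
    (fibreDiscriminant p d e a b c).totalDegree ≤ 2 := by
  have hsq : ∀ r : MvPolynomial (Fin n) ℤ, r.totalDegree ≤ 1 → (r ^ 2).totalDegree ≤ 2 :=
    fun r hr => (MvPolynomial.totalDegree_pow _ _).trans (by omega)
  refine (MvPolynomial.totalDegree_sub _ _).trans (max_le (hsq _ ?_) ?_)
  · exact (MvPolynomial.totalDegree_sub _ _).trans
      (max_le ((MvPolynomial.totalDegree_C_mul_le _ _).trans hd)
        ((MvPolynomial.totalDegree_C_mul_le _ _).trans he))
  · exact (MvPolynomial.totalDegree_C_mul_le _ _).trans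
      ((MvPolynomial.totalDegree_sub _ _).trans
        (max_le (hsq _ hd) ((MvPolynomial.totalDegree_C_mul_le _ _).trans hp)))

theorem exists_card_zeros_le_of_conic_fibres (n : ℕ) (ε : ℝ) (hε : 0 < ε) :
    ∃ C : ℝ, 0 < C ∧ ∀ (p d e : MvPolynomial (Fin n) ℤ) (a b c : ℤ) (u v : Fin n → ℤ),
      p.totalDegree ≤ 2 → d.totalDegree ≤ 1 → e.totalDegree ≤ 1 →
      (∀ i, |u i| ≤ 2) → (∀ i, |v i| ≤ 2) → a ≠ 0 → b ^ 2 - 4 * a * c ≠ 0 →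
      (∀ (s : Fin n → ℤ) (x y : ℤ), MvPolynomial.eval (s - x • u - y • v) p =
        a * x ^ 2 + b * (x * y) + c * y ^ 2 + MvPolynomial.eval s d * x + MvPolynomial.eval s e * y +
          MvPolynomial.eval s p) →
      (fibreDiscriminant p d e a b c ≠ 0 ∨ ¬ IsSquare (b ^ 2 - 4 * a * c)) →
      ∀ L : ℕ, 1 ≤ L → ∀ T : Finset (Fin n → ℤ), (∀ t ∈ T, ∀ i, |t i| ≤ L) →
      (∀ t ∈ T, MvPolynomial.eval t p = 0) → (T.card : ℝ) ≤ C * (L : ℝ) ^ ((n : ℝ) - 2 + ε) := by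
  classical
  obtain ⟨C, hC, hconic⟩ := exists_card_conic_zeros_le_rpow ε hε
  refine ⟨11 ^ n * (C + 5), by positivity, ?_⟩
  intro p d e a b c u v hp hd he hu hv ha hD hfib hN L hL T hTL hT
  set box := Fintype.piFinset fun _ : Fin n => Finset.Icc (-(5 * L : ℤ)) (5 * L) with hbox
  set W : (Fin n → ℤ) → Finset (ℤ × ℤ) := fun s =>
    (Finset.Icc (0 : ℤ) L ×ˢ Finset.Icc (0 : ℤ) L).filter
        fun α => s - α.1 • u - α.2 • v ∈ T with hWdef
  have hcard := card_mul_sq_le_sum_card_fibres u v L hu hv T hTL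
  change _ ≤ ∑ s ∈ box, (W s).card at hcard
  have hW : ∀ s, ∀ α ∈ W s, a * α.1 ^ 2 + b * (α.1 * α.2) + c * α.2 ^ 2 +
      MvPolynomial.eval s d * α.1 + MvPolynomial.eval s e * α.2 + MvPolynomial.eval s p = 0 := by
    intro s α hα
    rw [← hfib]
    exact hT _ (Finset.mem_filter.mp hα).2
  have hWL : ∀ s, ∀ α ∈ W s, (0 ≤ α.1 ∧ α.1 ≤ L) ∧ 0 ≤ α.2 ∧ α.2 ≤ L := by
    intro s α hα
    have := (Finset.mem_filter.mp hα).1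
    rwa [Finset.mem_product, Finset.mem_Icc, Finset.mem_Icc] at this
  have hIc : (Finset.Icc (-(5 * L : ℤ)) (5 * L)).card = 10 * L + 1 := by
    rw [Int.card_Icc]; omega
  have hboxc : box.card = (10 * L + 1) ^ n := by
    rw [hbox, Fintype.card_piFinset_const, hIc]
  have hLr : (1 : ℝ) ≤ L := by exact_mod_cast hL
  have hLε : 1 ≤ (L : ℝ) ^ ε := Real.one_le_rpow hLr hε.le
  have hsum : ((∑ s ∈ box, (W s).card : ℕ) : ℝ) ≤
      (10 * L + 1) ^ n * ((C + 5) * (L : ℝ) ^ ε) := by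
    by_cases hN0 : fibreDiscriminant p d e a b c = 0
    · have hsq := hN.resolve_left (not_not.mpr hN0)
      have h1 : ∑ s ∈ box, (W s).card ≤ ∑ _s ∈ box, 1 := by
        refine Finset.sum_le_sum fun s _ => card_conic_zeros_le_one ha hsq ?_ _ (hW s)
        rw [← eval_fibreDiscriminant, hN0, map_zero]
      rw [Finset.sum_const, hboxc, smul_eq_mul, mul_one] at h1
      calc ((∑ s ∈ box, (W s).card : ℕ) : ℝ) ≤ (((10 * L + 1) ^ n : ℕ) : ℝ) := by exact_mod_cast h1
        _ = (10 * L + 1) ^ n * 1 := by push_cast; ring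
        _ ≤ _ := by gcongr; nlinarith
    · have h1 : ∀ s ∈ box, ((W s).card : ℝ) ≤ C * (L : ℝ) ^ ε +
          if MvPolynomial.eval s (fibreDiscriminant p d e a b c) = 0 then 2 * ((L : ℝ) + 1) else 0 := by
        intro s _
        split_ifs with h
        · have := card_conic_zeros_le ha L (W s) (fun α hα => (hWL s α hα).2) (hW s)
          have h2 : ((W s).card : ℝ) ≤ 2 * ((L : ℝ) + 1) := by exact_mod_cast this
          have : 0 ≤ C * (L : ℝ) ^ ε := by positivity
          linarith
        · rw [eval_fibreDiscriminant] at h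
          rw [add_zero]
          refine hconic a b c _ _ _ L hL hD h (W s) (fun α hα => ?_) (hW s)
          obtain ⟨⟨k1, k2⟩, k3, k4⟩ := hWL s α hα
          rw [abs_of_nonneg k1, abs_of_nonneg k3]
          exact ⟨k2, k4⟩
      have h2 := MvPolynomial.card_zeros_mul_le hN0 (Finset.Icc (-(5 * L : ℤ)) (5 * L))
      rw [hIc] at h2
      set z := (box.filter fun s => MvPolynomial.eval s (fibreDiscriminant p d e a b c) = 0).card
        with hz
      have h3 : z * (10 * L + 1) ≤ 2 * (10 * L + 1) ^ n :=
        h2.trans (Nat.mul_le_mul_right _ (totalDegree_fibreDiscriminant_le a b c hp hd he))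
      have h3' : (z : ℝ) * (10 * L + 1) ≤ 2 * (10 * L + 1) ^ n := by exact_mod_cast h3
      have hb : (0 : ℝ) ≤ (10 * L + 1) ^ n := by positivity
      push_cast
      calc ∑ s ∈ box, ((W s).card : ℝ) ≤ _ := Finset.sum_le_sum h1
        _ = (10 * L + 1) ^ n * (C * (L : ℝ) ^ ε) + z * (2 * ((L : ℝ) + 1)) := by
            rw [Finset.sum_add_distrib, Finset.sum_const, hboxc, ← Finset.sum_filter,
              Finset.sum_const, nsmul_eq_mul, nsmul_eq_mul]
            push_cast
            ring
        _ ≤ (10 * L + 1) ^ n * (C * (L : ℝ) ^ ε) + 4 * (10 * L + 1) ^ n := by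
            have : (0 : ℝ) ≤ z := by positivity
            nlinarith
        _ ≤ _ := by nlinarith
  have hpow : (L : ℝ) ^ ((n : ℝ) - 2 + ε) = (L : ℝ) ^ n * (L : ℝ) ^ ε / (L : ℝ) ^ 2 := by
    rw [Real.rpow_add (by positivity), Real.rpow_sub (by positivity), Real.rpow_natCast,
      Real.rpow_two]
    ring
  rw [hpow, mul_div_assoc', le_div_iff₀ (by positivity)]
  have hcard' : (T.card : ℝ) * ((L : ℝ) + 1) ^ 2 ≤ ((∑ s ∈ box, (W s).card : ℕ) : ℝ) := by
    exact_mod_cast hcard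
  calc (T.card : ℝ) * (L : ℝ) ^ 2 ≤ (T.card : ℝ) * ((L : ℝ) + 1) ^ 2 := by gcongr; linarith
    _ ≤ (10 * L + 1) ^ n * ((C + 5) * (L : ℝ) ^ ε) := hcard'.trans hsum
    _ ≤ (11 * L) ^ n * ((C + 5) * (L : ℝ) ^ ε) := by gcongr; linarith
    _ = _ := by rw [mul_pow]; ring

/-! ### Polar form and expansion along a plane. -/

/-- The Gram matrix of the polar form of the quadratic part of `q`; it has integral entries. -/
noncomputable def polarMatrix {n : ℕ} (q : MvPolynomial (Fin n) ℤ) : Matrix (Fin n) (Fin n) ℤ :=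
  Matrix.of fun i j =>
    if i = j then 2 * q.coeff (Finsupp.single i 2)
    else q.coeff (Finsupp.single i 1 + Finsupp.single j 1)

theorem polarMatrix_isSymm {n : ℕ} (q : MvPolynomial (Fin n) ℤ) : (polarMatrix q).IsSymm := by
  ext i j
  simp only [polarMatrix, Matrix.transpose_apply, Matrix.of_apply]
  by_cases h : i = j
  · rw [h]
  · rw [if_neg h, if_neg (Ne.symm h), add_comm]

theorem formMatrix_quadraticPart_apply {n : ℕ} (q : MvPolynomial (Fin n) ℤ) (i j : Fin n) :
    formMatrix (quadraticPart q) i j = (polarMatrix q i j : ℚ) / 2 := by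
  simp only [formMatrix, quadraticPart, polarMatrix, Matrix.of_apply,
    MvPolynomial.coeff_homogeneousComponent]
  have h1 : (Finsupp.single i 2).degree = 2 := Finsupp.degree_single i 2
  have h2 : (Finsupp.single i 1 + Finsupp.single j 1).degree = 2 := by
    rw [map_add, Finsupp.degree_single, Finsupp.degree_single]
  rw [if_pos h1, if_pos h2]
  split_ifs with h
  · simp
  · rfl

theorem Finsupp.eq_of_degree_le_two {n : ℕ} (m : Fin n →₀ ℕ) (hm : m.degree ≤ 2) :
    m = 0 ∨ (∃ k, m = Finsupp.single k 1) ∨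
      ∃ k l, m = Finsupp.single k 1 + Finsupp.single l 1 := by
  have key : ∀ m : Fin n →₀ ℕ, m ≠ 0 → ∃ k m', m = Finsupp.single k 1 + m' := by
    intro m h
    obtain ⟨k, hk⟩ := Finsupp.ne_iff.mp h
    exact ⟨k, m - Finsupp.single k 1, (add_tsub_cancel_of_le
      (Finsupp.single_le_iff.mpr (Nat.one_le_iff_ne_zero.mpr hk))).symm⟩
  by_cases h0 : m = 0
  · exact Or.inl h0
  obtain ⟨k, m', rfl⟩ := key m h0
  by_cases h1 : m' = 0
  · exact Or.inr (Or.inl ⟨k, by rw [h1, add_zero]⟩)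
  obtain ⟨l, m'', rfl⟩ := key m' h1
  have h2 : m'' = 0 := by
    rw [map_add, map_add, Finsupp.degree_single, Finsupp.degree_single] at hm
    rw [← Finsupp.degree_eq_zero_iff]
    omega
  exact Or.inr (Or.inr ⟨k, l, by rw [h2, add_zero]⟩)

/-- Doubling makes the expansion integral: each mixed monomial occurs for (i, j) and for (j, i), and
each square once with a doubled coefficient. This is why the slicing is applied to 2q. -/
theorem two_mul_eq_polar_expansion {n : ℕ} (q : MvPolynomial (Fin n) ℤ) (hq : q.totalDegree ≤ 2) :
    MvPolynomial.C 2 * q = ∑ i, ∑ j, MvPolynomial.monomial (Finsupp.single i 1 + Finsupp.single j 1)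
        (polarMatrix q i j) +
      ∑ i, MvPolynomial.monomial (Finsupp.single i 1) (2 * q.coeff (Finsupp.single i 1)) +
      MvPolynomial.monomial 0 (2 * q.coeff 0) := by
  classical
  ext m
  simp only [MvPolynomial.coeff_C_mul, MvPolynomial.coeff_add, MvPolynomial.coeff_sum,
    MvPolynomial.coeff_monomial]
  by_cases hm : m.degree ≤ 2
  · have d1 : ∀ i : Fin n, (Finsupp.single i 1 : Fin n →₀ ℕ).degree = 1 :=
      fun i => Finsupp.degree_single i 1
    have d2 : ∀ i j : Fin n, (Finsupp.single i 1 + Finsupp.single j 1 : Fin n →₀ ℕ).degree = 2 :=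
      fun i j => by rw [map_add, d1, d1]
    have n1 : ∀ i : Fin n, (Finsupp.single i 1 : Fin n →₀ ℕ) ≠ 0 := fun i h => by
      have := d1 i; rw [h] at this; simp at this
    have n2 : ∀ i j : Fin n, (Finsupp.single i 1 + Finsupp.single j 1 : Fin n →₀ ℕ) ≠ 0 :=
      fun i j h => by have := d2 i j; rw [h] at this; simp at this
    have n3 : ∀ i j k : Fin n, (Finsupp.single i 1 + Finsupp.single j 1 : Fin n →₀ ℕ) ≠
        Finsupp.single k 1 := fun i j k h => by have := d2 i j; rw [h, d1] at this; omega
    rcases Finsupp.eq_of_degree_le_two m hm with rfl | ⟨k, rfl⟩ | ⟨k, l, rfl⟩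
    · simp [n1, n2]
    · simp [n3, (n1 k).symm, Finsupp.single_left_inj]
    · simp only [(n3 _ _ _).symm, (n2 _ _).symm, if_false, Finset.sum_const_zero, add_zero]
      have e : ∀ i j : Fin n, (Finsupp.single i 1 + Finsupp.single j 1 : Fin n →₀ ℕ) =
          Finsupp.single k 1 + Finsupp.single l 1 ↔ (i = k ∧ j = l) ∨ (i = l ∧ j = k) := by
        intro i j
        rw [Finsupp.single_add_single_eq_single_add_single one_ne_zero one_ne_zero]
        simp
      simp only [e]
      by_cases hkl : k = l
      · subst hkl
        have : ∀ i j : Fin n, (if (i = k ∧ j = k) ∨ (i = k ∧ j = k) then polarMatrix q i j else 0) =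
            if i = k then (if j = k then polarMatrix q i j else 0) else 0 := by
          intro i j; split_ifs <;> simp_all
        simp only [this, Finset.sum_ite_irrel, Finset.sum_const_zero, Finset.sum_ite_eq',
          Finset.mem_univ, if_true]
        rw [← Finsupp.single_add]
        simp [polarMatrix]
      · have : ∀ i j : Fin n, (if (i = k ∧ j = l) ∨ (i = l ∧ j = k) then polarMatrix q i j else 0) =
            (if i = k then (if j = l then polarMatrix q i j else 0) else 0) +
            if i = l then (if j = k then polarMatrix q i j else 0) else 0 := by
          intro i j
          have hlk := Ne.symm hkl
          split_ifs <;> simp_all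
        simp only [this, Finset.sum_add_distrib, Finset.sum_ite_irrel, Finset.sum_const_zero,
          Finset.sum_ite_eq', Finset.mem_univ, if_true]
        simp only [polarMatrix, Matrix.of_apply, if_neg hkl, if_neg (Ne.symm hkl)]
        rw [add_comm (Finsupp.single l 1)]
        ring
  · have hc : q.coeff m = 0 := by
      by_contra h
      exact hm ((MvPolynomial.le_totalDegree (MvPolynomial.mem_support_iff.mpr h)).trans hq)
    have m1 : ∀ i : Fin n, Finsupp.single i 1 ≠ m := by
      rintro i rfl; exact hm (by rw [Finsupp.degree_single]; omega)
    have m2 : ∀ i j : Fin n, Finsupp.single i 1 + Finsupp.single j 1 ≠ m := by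
      rintro i j rfl; exact hm (by rw [map_add, Finsupp.degree_single, Finsupp.degree_single])
    have m0 : 0 ≠ m := by rintro rfl; exact hm (by simp)
    simp [hc, m1, m2, m0]

theorem eval_two_mul_eq_polar {n : ℕ} (q : MvPolynomial (Fin n) ℤ) (hq : q.totalDegree ≤ 2)
    (t : Fin n → ℤ) : MvPolynomial.eval t (MvPolynomial.C 2 * q) =
      t ⬝ᵥ (polarMatrix q).mulVec t + 2 * ((fun i => q.coeff (Finsupp.single i 1)) ⬝ᵥ t) +
        2 * q.coeff 0 := by
  rw [two_mul_eq_polar_expansion q hq]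
  simp only [map_add, map_sum, MvPolynomial.eval_monomial, dotProduct, Matrix.mulVec,
    Finset.mul_sum]
  congr 1
  · congr 1
    · refine Finset.sum_congr rfl fun i _ => Finset.sum_congr rfl fun j _ => ?_
      rw [Finsupp.prod_add_index' (by simp) (by intros; rw [pow_add])]
      simp
      ring
    · refine Finset.sum_congr rfl fun i _ => ?_
      simp
      ring
  · simp

/-- A polynomial whose values are affine: `-2 * (w ⬝ᵥ s + k)`. -/
noncomputable def affinePolynomial {n : ℕ} (w : Fin n → ℤ) (k : ℤ) : MvPolynomial (Fin n) ℤ :=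
  MvPolynomial.C (-2) * (∑ i, MvPolynomial.C (w i) * MvPolynomial.X i + MvPolynomial.C k)

theorem eval_affinePolynomial {n : ℕ} (w s : Fin n → ℤ) (k : ℤ) :
    MvPolynomial.eval s (affinePolynomial w k) = -2 * (w ⬝ᵥ s + k) := by
  simp [affinePolynomial, dotProduct]

theorem totalDegree_affinePolynomial_le {n : ℕ} (w : Fin n → ℤ) (k : ℤ) :
    (affinePolynomial w k).totalDegree ≤ 1 := by
  refine (MvPolynomial.totalDegree_C_mul_le _ _).trans ((MvPolynomial.totalDegree_add _ _).trans
    (max_le (MvPolynomial.totalDegree_finsetSum_le fun i _ =>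
      (MvPolynomial.totalDegree_C_mul_le _ _).trans ?_) ?_))
  · rw [MvPolynomial.totalDegree_X]
  · rw [MvPolynomial.totalDegree_C]; omega

theorem Matrix.IsSymm.dotProduct_mulVec_comm {n : ℕ} {A : Matrix (Fin n) (Fin n) ℤ}
    (hA : A.IsSymm) (x y : Fin n → ℤ) : x ⬝ᵥ A.mulVec y = y ⬝ᵥ A.mulVec x := by
  rw [Matrix.dotProduct_mulVec, ← Matrix.mulVec_transpose, hA.eq, dotProduct_comm]

theorem eval_sub_smul_sub_smul {n : ℕ} (q : MvPolynomial (Fin n) ℤ) (hq : q.totalDegree ≤ 2)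
    (u v s : Fin n → ℤ) (x y : ℤ) :
    MvPolynomial.eval (s - x • u - y • v) (MvPolynomial.C 2 * q) =
      (u ⬝ᵥ (polarMatrix q).mulVec u) * x ^ 2 + (2 * (u ⬝ᵥ (polarMatrix q).mulVec v)) * (x * y) +
      (v ⬝ᵥ (polarMatrix q).mulVec v) * y ^ 2 +
      MvPolynomial.eval s (affinePolynomial ((polarMatrix q).mulVec u)
        ((fun i => q.coeff (Finsupp.single i 1)) ⬝ᵥ u)) * x +
      MvPolynomial.eval s (affinePolynomial ((polarMatrix q).mulVec v)
        ((fun i => q.coeff (Finsupp.single i 1)) ⬝ᵥ v)) * y +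
      MvPolynomial.eval s (MvPolynomial.C 2 * q) := by
  rw [eval_two_mul_eq_polar q hq, eval_two_mul_eq_polar q hq, eval_affinePolynomial,
    eval_affinePolynomial, dotProduct_comm _ s, dotProduct_comm _ s]
  have hs := polarMatrix_isSymm q
  set A := polarMatrix q
  simp only [Matrix.mulVec_sub, Matrix.mulVec_smul, dotProduct_sub, sub_dotProduct, dotProduct_smul,
    smul_dotProduct, smul_eq_mul]
  rw [hs.dotProduct_mulVec_comm u s, hs.dotProduct_mulVec_comm v s, hs.dotProduct_mulVec_comm v u]
  ring

/-! ### Choice of the plane, and irreducibility. -/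

/-- Polarisation: the values at the vectors e_i + e_j determine the matrix. The case i = j gives
2e_i, hence the bound 2. -/
theorem Matrix.IsSymm.exists_small_dotProduct_mulVec_ne_zero {n : ℕ} {A : Matrix (Fin n) (Fin n) ℤ}
    (hA : A.IsSymm) (h0 : A ≠ 0) :
    ∃ u : Fin n → ℤ, (∀ i, |u i| ≤ 2) ∧ u ⬝ᵥ A.mulVec u ≠ 0 := by
  by_contra! h
  have key : ∀ i j, A i i + 2 * A i j + A j j = 0 := by
    intro i j
    have := h (Pi.single i 1 + Pi.single j 1) (fun k => by
      simp only [Pi.add_apply, Pi.single_apply]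
      split_ifs <;> norm_num)
    simp only [Matrix.mulVec_add, Matrix.mulVec_single_one, dotProduct_add, add_dotProduct,
      single_one_dotProduct, Matrix.col_apply] at this
    have hs : A j i = A i j := hA.apply i j
    rw [hs] at this
    linarith
  refine h0 (Matrix.ext fun i j => ?_)
  have h1 := key i i
  have h2 := key j j
  have h3 := key i j
  simp only [Matrix.zero_apply]
  omega

/-- Once u is found with a = uᵀAu ≠ 0, set w = Au. A quarter of the discriminant is the value at v
of the quadratic form with matrix w wᵀ - aA. Were this matrix zero, A would have rank at most one;
so the previous lemma also supplies v. -/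
theorem Matrix.IsSymm.exists_small_discriminant_ne_zero {n : ℕ} {A : Matrix (Fin n) (Fin n) ℤ}
    (hA : A.IsSymm) (hr : 2 ≤ (A.map (Int.cast : ℤ → ℚ)).rank) :
    ∃ u v : Fin n → ℤ, (∀ i, |u i| ≤ 2) ∧ (∀ i, |v i| ≤ 2) ∧ u ⬝ᵥ A.mulVec u ≠ 0 ∧
      (2 * (u ⬝ᵥ A.mulVec v)) ^ 2 - 4 * (u ⬝ᵥ A.mulVec u) * (v ⬝ᵥ A.mulVec v) ≠ 0 := by
  have hA0 : A ≠ 0 := by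
    rintro rfl
    simp at hr
  obtain ⟨u, hu, hua⟩ := hA.exists_small_dotProduct_mulVec_ne_zero hA0
  set a := u ⬝ᵥ A.mulVec u with ha
  set w := A.mulVec u with hw
  have hsymm : (Matrix.vecMulVec w w - a • A).IsSymm := by
    ext i j
    simp only [Matrix.transpose_apply, Matrix.sub_apply, Matrix.vecMulVec_apply, Matrix.smul_apply,
      hA.apply i j]
    ring
  have hne : Matrix.vecMulVec w w - a • A ≠ 0 := by
    intro h
    have haq : (a : ℚ) ≠ 0 := by exact_mod_cast hua
    have hmap : A.map (Int.cast : ℤ → ℚ) =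
        Matrix.vecMulVec (fun i => (w i : ℚ) / a) (fun i => (w i : ℚ)) := by
      ext i j
      have := congrFun (congrFun h i) j
      simp only [Matrix.sub_apply, Matrix.vecMulVec_apply, Matrix.smul_apply, smul_eq_mul,
        Matrix.zero_apply] at this
      have h2 : (w i : ℚ) * w j - a * A i j = 0 := by exact_mod_cast this
      rw [Matrix.map_apply, Matrix.vecMulVec_apply]
      field_simp
      linarith
    rw [hmap] at hr
    have := Matrix.rank_vecMulVec_le (fun i => (w i : ℚ) / a) (fun i => (w i : ℚ))
    omega
  obtain ⟨v, hv, hva⟩ := hsymm.exists_small_dotProduct_mulVec_ne_zero hne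
  refine ⟨u, v, hu, hv, hua, ?_⟩
  have e : v ⬝ᵥ (Matrix.vecMulVec w w - a • A).mulVec v =
      (u ⬝ᵥ A.mulVec v) ^ 2 - a * (v ⬝ᵥ A.mulVec v) := by
    rw [hA.dotProduct_mulVec_comm u v, ← hw, Matrix.sub_mulVec, dotProduct_sub, Matrix.smul_mulVec,
      dotProduct_smul, Matrix.vecMulVec_mulVec, smul_eq_mul, dotProduct_smul, dotProduct_comm w v]
    simp [sq]
  rw [e] at hva
  intro h
  apply hva
  linarith

theorem fibreDiscriminant_ne_zero_of_irreducible {n : ℕ} {q d e : MvPolynomial (Fin n) ℤ}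
    {a b c : ℤ} (hq : q.totalDegree = 2) (hirr : Irreducible (MvPolynomial.map (Int.castRingHom ℚ) q))
    (hd : d.totalDegree ≤ 1) (he : e.totalDegree ≤ 1) (ha : a ≠ 0) (hD : b ^ 2 - 4 * a * c ≠ 0)
    (hsq : IsSquare (b ^ 2 - 4 * a * c)) :
    fibreDiscriminant (MvPolynomial.C 2 * q) d e a b c ≠ 0 := by
  intro h
  obtain ⟨k, hk⟩ := hsq
  have hk0 : k ≠ 0 := by rintro rfl; exact hD (by simpa using hk)
  have hdeg : (MvPolynomial.map (Int.castRingHom ℚ) q).totalDegree = 2 := by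
    rw [← hq, MvPolynomial.totalDegree, MvPolynomial.totalDegree,
      MvPolynomial.support_map_of_injective _ (RingHom.injective_int (Int.castRingHom ℚ))]
  set G := MvPolynomial.C k * d - (MvPolynomial.C b * d - MvPolynomial.C (2 * a) * e) with hG
  set H := MvPolynomial.C k * d + (MvPolynomial.C b * d - MvPolynomial.C (2 * a) * e) with hH
  have hM : (MvPolynomial.C b * d - MvPolynomial.C (2 * a) * e).totalDegree ≤ 1 :=
    (MvPolynomial.totalDegree_sub _ _).trans
      (max_le ((MvPolynomial.totalDegree_C_mul_le _ _).trans hd)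
        ((MvPolynomial.totalDegree_C_mul_le _ _).trans he))
  have hGd : G.totalDegree ≤ 1 := (MvPolynomial.totalDegree_sub _ _).trans
    (max_le ((MvPolynomial.totalDegree_C_mul_le _ _).trans hd) hM)
  have hHd : H.totalDegree ≤ 1 := (MvPolynomial.totalDegree_add _ _).trans
    (max_le ((MvPolynomial.totalDegree_C_mul_le _ _).trans hd) hM)
  have hmapd : ∀ r : MvPolynomial (Fin n) ℤ,
      (MvPolynomial.map (Int.castRingHom ℚ) r).totalDegree = r.totalDegree := fun r => by
    rw [MvPolynomial.totalDegree, MvPolynomial.totalDegree,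
      MvPolynomial.support_map_of_injective _ (RingHom.injective_int (Int.castRingHom ℚ))]
  -- With D = k² and M = bd - 2ae, vanishing says M² = k²(d² - 8aq), so 8ak²q is the product of kd -
  -- M and kd + M. Both have degree at most 1, and by irreducibility one would be constant, too
  -- small for degree 2.
  have hGH : MvPolynomial.C (8 * a * k ^ 2) * q = G * H := by
    rw [fibreDiscriminant, hk] at h
    simp only [hG, hH, map_mul, map_pow, map_ofNat] at h ⊢
    linear_combination h
  have hmap := congrArg (MvPolynomial.map (Int.castRingHom ℚ)) hGH
  rw [map_mul _ (MvPolynomial.C _), map_mul _ G, MvPolynomial.map_C] at hmap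
  set m : ℚ := Int.castRingHom ℚ (8 * a * k ^ 2) with hm
  have hm0 : m ≠ 0 := by
    rw [hm, eq_intCast, Int.cast_ne_zero]
    exact mul_ne_zero (mul_ne_zero (by norm_num) ha) (pow_ne_zero 2 hk0)
  have hmu : IsUnit (MvPolynomial.C m : MvPolynomial (Fin n) ℚ) := (IsUnit.mk0 m hm0).map _
  have hirr' := (irreducible_isUnit_mul hmu).mpr hirr
  have hCdeg : (MvPolynomial.C m * MvPolynomial.map (Int.castRingHom ℚ) q).totalDegree = 2 := by
    rw [← hdeg, MvPolynomial.totalDegree_mul_of_isDomain hmu.ne_zero hirr.ne_zero,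
      MvPolynomial.totalDegree_C, zero_add]
  have hmul := MvPolynomial.totalDegree_mul (MvPolynomial.map (Int.castRingHom ℚ) G)
    (MvPolynomial.map (Int.castRingHom ℚ) H)
  rw [← hmap, hCdeg, hmapd, hmapd] at hmul
  rw [hmap] at hirr'
  rcases hirr'.isUnit_or_isUnit rfl with hu | hu
  · have := (MvPolynomial.isUnit_iff_totalDegree_of_isReduced.mp hu).2
    rw [hmapd] at this
    omega
  · have := (MvPolynomial.isUnit_iff_totalDegree_of_isReduced.mp hu).2
    rw [hmapd] at this
    omega

/-! ### Conclusion. -/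

theorem theorem1p8 (ν : ℕ) (hν : 2 ≤ ν) (ε : ℝ) (hε : 0 < ε) :
    ∃ C : ℝ, ∀ q : MvPolynomial (Fin ν) ℤ,
      q.totalDegree = 2 →
      Irreducible (MvPolynomial.map (Int.castRingHom ℚ) q) →
      2 ≤ (formMatrix (quadraticPart q)).rank →
      ∀ B : ℝ, 1 ≤ B → (zeroCount q B : ℝ) ≤ C * B ^ ((ν : ℝ) - 2 + ε) := by
  obtain ⟨C, hC, hcount⟩ := exists_card_zeros_le_of_conic_fibres ν ε hε
  refine ⟨C, fun q hq hirr hrank B hB => ?_⟩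
  have hr : 2 ≤ ((polarMatrix q).map (Int.cast : ℤ → ℚ)).rank := by
    have h1 : (polarMatrix q).map (Int.cast : ℤ → ℚ) = (2 : ℚ) • formMatrix (quadraticPart q) := by
      ext i j
      rw [Matrix.smul_apply, formMatrix_quadraticPart_apply, Matrix.map_apply, smul_eq_mul]
      ring
    have h2 : formMatrix (quadraticPart q) =
        (1 / 2 : ℚ) • (polarMatrix q).map (Int.cast : ℤ → ℚ) := by
      rw [h1, smul_smul]; norm_num
    rw [h2] at hrank
    refine hrank.trans ?_
    rw [← Matrix.mul_one (_ • _), Matrix.smul_mul, ← Matrix.mul_smul]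
    exact Matrix.rank_mul_le_left _ _
  obtain ⟨u, v, hu, hv, ha, hD⟩ := (polarMatrix_isSymm q).exists_small_discriminant_ne_zero hr
  -- Integer points only see the integral part of B; as the exponent is nonnegative for ν ≥ 2, the
  -- bound in L passes to B.
  set L := ⌊B⌋₊ with hL
  have hL1 : 1 ≤ L := Nat.one_le_floor_iff _ |>.mpr hB
  have hLB : (L : ℝ) ≤ B := Nat.floor_le (by linarith)
  set T := (zerosInBox_finite q B).toFinset with hT
  have hTmem : ∀ t ∈ T, (∀ i, |(t i : ℝ)| ≤ B) ∧ MvPolynomial.eval t q = 0 := fun t ht =>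
    (zerosInBox_finite q B).mem_toFinset.mp ht
  have hzc : zeroCount q B = T.card := Set.ncard_eq_toFinset_card _ _
  have hν' : (2 : ℝ) ≤ ν := by exact_mod_cast hν
  have main := hcount (MvPolynomial.C 2 * q) _ _ _ _ _ u v
    ((MvPolynomial.totalDegree_C_mul_le _ _).trans hq.le) (totalDegree_affinePolynomial_le _ _)
    (totalDegree_affinePolynomial_le _ _) hu hv ha hD (eval_sub_smul_sub_smul q hq.le u v) ?_ L hL1 T
    (fun t ht i => ?_) (fun t ht => by rw [map_mul, (hTmem t ht).2, mul_zero])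
  · rw [hzc]
    refine main.trans ?_
    gcongr
  · by_cases hsq : IsSquare ((2 * (u ⬝ᵥ (polarMatrix q).mulVec v)) ^ 2 -
      4 * (u ⬝ᵥ (polarMatrix q).mulVec u) * (v ⬝ᵥ (polarMatrix q).mulVec v))
    · exact Or.inl (fibreDiscriminant_ne_zero_of_irreducible hq hirr
        (totalDegree_affinePolynomial_le _ _) (totalDegree_affinePolynomial_le _ _) ha hD hsq)
    · exact Or.inr hsq
  · have h1 := (hTmem t ht).1 i
    have h2 : ((t i).natAbs : ℝ) ≤ B := by rwa [Nat.cast_natAbs, Int.cast_abs]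
    have h3 : (t i).natAbs ≤ L := Nat.le_floor h2
    rw [Int.abs_eq_natAbs]
    exact_mod_cast h3
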